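/- Let $\mathbb N=\{1,2,3,\dots\}$. For finite sets $E,F\subset\mathbb N$ write $E<F$ if every element of $E$ is smaller than every element of $F$. For every countable limit ordinal $\lambda$ fix a strictly increasing sequence of ordinals $(\lambda_n)_{n\ge1}$ with supremum $\lambda$. Define the Schreier families $\mathcal S_\alpha$, $\alpha<\omega_1$, by $\mathcal S_0=\{\varnothing\}\cup\{\{n\}:n\in\mathbb N\}$, $$\mathcal S_{\alpha+1}=\Bigl\{\bigcup_{k=1}^nE_k:\ E_k\in\mathcal S_\alpha,\ E_1<\dots<E_n,\ n\le\min\bigcup_{k=1}^n E_k\Bigr\},$$ $$\mathcal S_\lambda=\{E:\ \exists\, n\le\min E,\ E\in\mathcal S_{\lambda_n+1}\}\quad(\lambda\text{ a limit ordinal}),$$ with $\min\varnothing=\infty$. For a finitely supported real sequence $x\in c_{00}$ put $\|x\|_\alpha=\sup_{E\in\mathcal S_\alpha}\sum_{i\in E}|x_i|$, and for $1<p<\infty$ let $X^p_\alpha$ be the completion of $c_{00}$ under the norm $$\|x\|_{X^p_\alpha}=\sup\Bigl\{\Bigl(\sum_{n=1}^\infty\bigl\|P_{[k_{n-1},k_n)}x\bigr\|_\alpha^p\Bigr)^{1/p}:\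 1\le k_0<k_1<\cdots\Bigr\},$$ where $P_{[k,l)}x$ is the restriction of $x$ to $\{k,\dots,l-1\}$. **Lemma.** Let $\alpha<\omega_1$ and $1<p<\infty$. The unit vectors $(e_n)$ form a normalized, $1$-unconditional Schauder basis of $X^p_\alpha$, and this basis is: 1. shrinking: the closed linear span of the coordinate functionals $(e_n^*)$ is the whole dual $(X^p_\alpha)^*$; 2. boundedly complete: if $\sup_N\bigl\|\sum_{n=1}^Nc_ne_n\bigr\|<\infty$ for scalars $(c_n)$, then $\sum_{n=1}^\infty c_ne_n$ converges in $X^p_\alpha$; 3. $1$-right dominant: if $m_1<m_2<\cdots$ and $k_1<k_2<\cdots$ are natural numbers with $m_n\le k_n$ for all $n$, then $\bigl\|\sum_n a_ne_{m_n}\bigr\|\le\bigl\|\sum_n a_ne_{k_n}\bigr\|$ for all finitely supported real sequences $(a_n)$; 4. and it satisfies subsequential $4$-$X^p_\alpha$-upper block estimates in $X^p_\alpha$: if $(z_n)$ is a normalized block sequence of $(e_n)$ (norm-one vectors with finite supports, $\max\operatorname{supp}z_n<\min\operatorname{supp}z_{n+1}$) and $m_n=\min\operatorname{supp}z_n$,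 then $\bigl\|\sum_n a_nz_n\bigr\|\le4\bigl\|\sum_n a_ne_{m_n}\bigr\|$ for all finitely supported real sequences $(a_n)$. -/

import Mathlib

/-! Throughout, `ℕ+ = {1, 2, 3, …}` plays the role of the index set `ℕ` of a basis. -/

noncomputable section

namespace Baernstein

open Filter Topology

/-! ### Schreier families -/

/-- A choice, for every countable limit ordinal `l`, of a sequence `a l 1 < a l 2 < …` of
ordinals increasing strictly to `l`. -/
def IsLimitSystem (a : Ordinal.{0} → ℕ+ → Ordinal.{0}) : Prop :=
  ∀ l : Ordinal.{0}, l < Ordinal.omega 1 → Order.IsSuccLimit l →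
    StrictMono (a l) ∧ IsLUB (Set.range (a l)) l

/-- `E < F` for finite sets: every element of `E` is smaller than every element of `F`
(no condition if one of them is empty). -/
def SetLT (E F : Finset ℕ+) : Prop := ∀ i ∈ E, ∀ j ∈ F, i < j

/-- The successor step: all unions `E₁ ∪ ⋯ ∪ Eₙ` with `E₁ < ⋯ < Eₙ` in the family `S` and
`n` at most the minimum of the union. (Some of the `Eₖ` may be empty; dropping these only
decreases `n`.) -/
def schreierSucc (S : Set (Finset ℕ+)) : Set (Finset ℕ+) :=
  {E | ∃ (n : ℕ) (D : Fin n → Finset ℕ+), (∀ k, D k ∈ S) ∧ (∀ k l, k < l → SetLT (D k) (D l)) ∧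
    (∀ i ∈ E, n ≤ (i : ℕ)) ∧ E = Finset.univ.biUnion D}

/-- The Schreier family `S_α`, by transfinite recursion: `S_0` consists of the sets with at most
one element, `S_{α+1}` is given by `schreierSucc`, and for a limit ordinal `l`,
`S_l = {E : ∃ n ≤ min E, E ∈ S_{a l n + 1}}`. (The condition `a l n + 1 < l` is automatic
for an `IsLimitSystem`.) -/
def schreierFamily (a : Ordinal.{0} → ℕ+ → Ordinal.{0}) (α : Ordinal.{0}) : Set (Finset ℕ+) :=
  Ordinal.limitRecOn (motive := fun _ => Set (Finset ℕ+)) α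
    {E | E.card ≤ 1}
    (fun _ S => schreierSucc S)
    (fun l _ S => {E | ∃ (n : ℕ+) (h : a l n + 1 < l), (∀ i ∈ E, n ≤ i) ∧ E ∈ S (a l n + 1) h})

theorem schreierFamily_zero (a : Ordinal.{0} → ℕ+ → Ordinal.{0}) :
    schreierFamily a 0 = {E | E.card ≤ 1} := by
  simp [schreierFamily]

theorem schreierFamily_add_one (a : Ordinal.{0} → ℕ+ → Ordinal.{0}) (α : Ordinal.{0}) :
    schreierFamily a (α + 1) = schreierSucc (schreierFamily a α) := by
  simp [schreierFamily]

theorem schreierFamily_limit (a : Ordinal.{0} → ℕ+ → Ordinal.{0}) (ha : IsLimitSystem a)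
    (l : Ordinal.{0}) (hl : Order.IsSuccLimit l) (hl1 : l < Ordinal.omega 1) :
    schreierFamily a l =
      {E | ∃ n : ℕ+, (∀ i ∈ E, n ≤ i) ∧ E ∈ schreierFamily a (a l n + 1)} := by
  have key : ∀ n, a l n + 1 < l := fun n => by
    obtain ⟨h1, h2⟩ := ha l hl1 hl
    exact hl.add_one_lt ((h1 (PNat.lt_add_right n 1)).trans_le (h2.1 ⟨n + 1, rfl⟩))
  ext E
  rw [schreierFamily, Ordinal.limitRecOn_limit _ _ _ _ hl]
  simp only [Set.mem_ofPred_eq]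
  exact ⟨fun ⟨n, _, h⟩ => ⟨n, h⟩, fun ⟨n, h⟩ => ⟨n, key n, h⟩⟩

/-! ### The Schreier norm and the Baernstein norm on `c₀₀` -/

/-- `‖x‖_F = sup_{E ∈ F} ‖E x‖₁` for `x ∈ c₀₀`. -/
def schreierNorm (F : Set (Finset ℕ+)) (x : ℕ+ →₀ ℝ) : ℝ :=
  ⨆ E : F, ∑ i ∈ E.1, |x i|

/-- The restriction `P_{[m, n)} x` of `x ∈ c₀₀` to the interval `[m, n)`. -/
def intervalProj (m n : ℕ+) (x : ℕ+ →₀ ℝ) : ℕ+ →₀ ℝ :=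
  x.filter (fun i => m ≤ i ∧ i < n)

/-- The norm of `(X_F)^{ℓ_p}` on `c₀₀`:
`sup { (∑ₙ ‖P_{[kₙ, kₙ₊₁)} x‖_F ^ p) ^ (1/p) : 1 ≤ k₀ < k₁ < ⋯ }`. -/
def baernsteinNorm (F : Set (Finset ℕ+)) (p : ℝ) (x : ℕ+ →₀ ℝ) : ℝ :=
  ⨆ k : {k : ℕ → ℕ+ // StrictMono k},
    (∑' n : ℕ, schreierNorm F (intervalProj (k.1 n) (k.1 (n + 1)) x) ^ p) ^ (1 / p)

/-! ### Facts needed for the norm axioms -/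

theorem sum_abs_le (E : Finset ℕ+) (x : ℕ+ →₀ ℝ) :
    ∑ i ∈ E, |x i| ≤ ∑ i ∈ x.support, |x i| := by
  classical
  rw [← Finset.sum_filter_of_ne (s := E) (p := fun i => i ∈ x.support)]
  · exact Finset.sum_le_sum_of_subset_of_nonneg (fun i hi => (Finset.mem_filter.1 hi).2)
      fun _ _ _ => abs_nonneg _
  · intro i _ h
    simpa using h

theorem schreier_bddAbove (F : Set (Finset ℕ+)) (x : ℕ+ →₀ ℝ) :
    BddAbove (Set.range fun E : F => ∑ i ∈ E.1, |x i|) :=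
  ⟨∑ i ∈ x.support, |x i|, by rintro _ ⟨E, rfl⟩; exact sum_abs_le E.1 x⟩

theorem schreierNorm_nonneg (F : Set (Finset ℕ+)) (x : ℕ+ →₀ ℝ) : 0 ≤ schreierNorm F x :=
  Real.iSup_nonneg fun _ => Finset.sum_nonneg fun _ _ => abs_nonneg _

theorem schreierNorm_le (F : Set (Finset ℕ+)) (x : ℕ+ →₀ ℝ) :
    schreierNorm F x ≤ ∑ i ∈ x.support, |x i| :=
  Real.iSup_le (fun E => sum_abs_le E.1 x) (Finset.sum_nonneg fun _ _ => abs_nonneg _)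

theorem schreierNorm_zero (F : Set (Finset ℕ+)) : schreierNorm F 0 = 0 := by
  simp [schreierNorm]

theorem schreierNorm_add_le (F : Set (Finset ℕ+)) (x y : ℕ+ →₀ ℝ) :
    schreierNorm F (x + y) ≤ schreierNorm F x + schreierNorm F y := by
  refine Real.iSup_le (fun E => ?_)
    (add_nonneg (schreierNorm_nonneg F x) (schreierNorm_nonneg F y))
  calc ∑ i ∈ E.1, |(x + y) i| ≤ ∑ i ∈ E.1, (|x i| + |y i|) :=
        Finset.sum_le_sum fun i _ => abs_add_le _ _
    _ = ∑ i ∈ E.1, |x i| + ∑ i ∈ E.1, |y i| := Finset.sum_add_distrib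
    _ ≤ _ := add_le_add (le_ciSup (schreier_bddAbove F x) E) (le_ciSup (schreier_bddAbove F y) E)

theorem schreierNorm_smul (F : Set (Finset ℕ+)) (c : ℝ) (x : ℕ+ →₀ ℝ) :
    schreierNorm F (c • x) = |c| * schreierNorm F x := by
  simp only [schreierNorm, Finsupp.smul_apply, smul_eq_mul, abs_mul, ← Finset.mul_sum]
  exact (Real.mul_iSup_of_nonneg (abs_nonneg c) _).symm

theorem intervalProj_add (m n : ℕ+) (x y : ℕ+ →₀ ℝ) :
    intervalProj m n (x + y) = intervalProj m n x + intervalProj m n y :=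
  Finsupp.filter_add

theorem intervalProj_smul (m n : ℕ+) (c : ℝ) (x : ℕ+ →₀ ℝ) :
    intervalProj m n (c • x) = c • intervalProj m n x :=
  Finsupp.filter_smul

/-- For strictly increasing `k`, only finitely many of the restrictions to `[kₙ, kₙ₊₁)` are
nonzero. -/
theorem exists_forall_intervalProj_eq_zero (x : ℕ+ →₀ ℝ) (k : ℕ → ℕ+) (hk : StrictMono k) :
    ∃ N : ℕ, ∀ n, N ≤ n → intervalProj (k n) (k (n + 1)) x = 0 := by
  refine ⟨x.support.sup (fun i => (i : ℕ)) + 1, fun n hn => ?_⟩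
  ext i
  rw [intervalProj, Finsupp.filter_apply]
  split_ifs with h
  · by_contra hi
    have h1 : (i : ℕ) ≤ x.support.sup (fun i => (i : ℕ)) :=
      Finset.le_sup (f := fun i : ℕ+ => (i : ℕ)) (Finsupp.mem_support_iff.2 hi)
    have h2 : n ≤ (k n : ℕ) := by
      have : StrictMono fun n => (k n : ℕ) := fun a b hab => hk hab
      exact this.id_le n
    have h3 : (k n : ℕ) ≤ i := h.1
    omega
  · rfl

theorem summable_blocks (F : Set (Finset ℕ+)) {p : ℝ} (hp : 1 ≤ p) (x : ℕ+ →₀ ℝ)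
    (k : ℕ → ℕ+) (hk : StrictMono k) :
    Summable fun n : ℕ => schreierNorm F (intervalProj (k n) (k (n + 1)) x) ^ p := by
  obtain ⟨N, hN⟩ := exists_forall_intervalProj_eq_zero x k hk
  refine summable_of_ne_finset_zero (s := Finset.range N) fun n hn => ?_
  rw [hN n (by simpa using hn), schreierNorm_zero, Real.zero_rpow (by linarith)]

theorem baernstein_bddAbove (F : Set (Finset ℕ+)) {p : ℝ} (hp : 1 ≤ p) (x : ℕ+ →₀ ℝ) :
    BddAbove (Set.range fun k : {k : ℕ → ℕ+ // StrictMono k} =>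
      (∑' n : ℕ, schreierNorm F (intervalProj (k.1 n) (k.1 (n + 1)) x) ^ p) ^ (1 / p)) := by
  classical
  set M := x.support.sup (fun i => (i : ℕ)) + 1 with hM
  refine ⟨((M : ℝ) * (∑ i ∈ x.support, |x i|) ^ p) ^ (1 / p), ?_⟩
  rintro _ ⟨⟨k, hk⟩, rfl⟩
  have hzero : ∀ n, n ∉ Finset.range M →
      schreierNorm F (intervalProj (k n) (k (n + 1)) x) ^ p = 0 := by
    intro n hn
    have hz : intervalProj (k n) (k (n + 1)) x = 0 := by
      ext i
      rw [intervalProj, Finsupp.filter_apply]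
      split_ifs with h
      · by_contra hi
        have h1 : (i : ℕ) ≤ x.support.sup (fun i => (i : ℕ)) :=
          Finset.le_sup (f := fun i : ℕ+ => (i : ℕ)) (Finsupp.mem_support_iff.2 hi)
        have h2 : n ≤ (k n : ℕ) := by
          have : StrictMono fun n => (k n : ℕ) := fun a b hab => hk hab
          exact this.id_le n
        have h3 : (k n : ℕ) ≤ i := h.1
        simp only [Finset.mem_range] at hn
        omega
      · rfl
    rw [hz, schreierNorm_zero, Real.zero_rpow (by linarith)]
  have hb : ∀ n, schreierNorm F (intervalProj (k n) (k (n + 1)) x) ≤ ∑ i ∈ x.support, |x i| := by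
    intro n
    refine (schreierNorm_le F _).trans ?_
    refine (Finset.sum_le_sum fun i _ => ?_).trans (sum_abs_le _ x)
    rw [intervalProj, Finsupp.filter_apply]
    split_ifs
    · exact le_rfl
    · simp
  refine Real.rpow_le_rpow (tsum_nonneg fun n => Real.rpow_nonneg (schreierNorm_nonneg F _) _) ?_
    (by positivity)
  simp only
  rw [tsum_eq_sum hzero]
  calc _ ≤ ∑ _n ∈ Finset.range M, (∑ i ∈ x.support, |x i|) ^ p :=
        Finset.sum_le_sum fun n _ =>
          Real.rpow_le_rpow (schreierNorm_nonneg F _) (hb n) (by linarith)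
    _ = _ := by simp

theorem baernsteinNorm_nonneg (F : Set (Finset ℕ+)) (p : ℝ) (x : ℕ+ →₀ ℝ) :
    0 ≤ baernsteinNorm F p x :=
  Real.iSup_nonneg fun _ => Real.rpow_nonneg
    (tsum_nonneg fun _ => Real.rpow_nonneg (schreierNorm_nonneg F _) _) _

theorem baernsteinNorm_add_le (F : Set (Finset ℕ+)) {p : ℝ} (hp : 1 ≤ p) (x y : ℕ+ →₀ ℝ) :
    baernsteinNorm F p (x + y) ≤ baernsteinNorm F p x + baernsteinNorm F p y := by
  refine Real.iSup_le (fun k => ?_)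
    (add_nonneg (baernsteinNorm_nonneg F p x) (baernsteinNorm_nonneg F p y))
  obtain ⟨h1, h2⟩ := Real.Lp_add_le_tsum_of_nonneg hp
    (fun n => schreierNorm_nonneg F (intervalProj (k.1 n) (k.1 (n + 1)) x))
    (fun n => schreierNorm_nonneg F (intervalProj (k.1 n) (k.1 (n + 1)) y))
    (summable_blocks F hp x k.1 k.2) (summable_blocks F hp y k.1 k.2)
  refine le_trans ?_ (h2.trans (add_le_add (le_ciSup (baernstein_bddAbove F hp x) k)
    (le_ciSup (baernstein_bddAbove F hp y) k)))
  refine Real.rpow_le_rpow (tsum_nonneg fun n => Real.rpow_nonneg (schreierNorm_nonneg F _) _) ?_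
    (by positivity)
  refine (summable_blocks F hp (x + y) k.1 k.2).tsum_le_tsum (fun n => ?_) h1
  refine Real.rpow_le_rpow (schreierNorm_nonneg F _) ?_ (by linarith)
  rw [intervalProj_add]
  exact schreierNorm_add_le F _ _

theorem baernsteinNorm_smul (F : Set (Finset ℕ+)) {p : ℝ} (hp : 1 ≤ p) (c : ℝ) (x : ℕ+ →₀ ℝ) :
    baernsteinNorm F p (c • x) = |c| * baernsteinNorm F p x := by
  rw [baernsteinNorm, baernsteinNorm, Real.mul_iSup_of_nonneg (abs_nonneg c)]
  congr 1
  ext k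
  have h0 : (0 : ℝ) ≤ ∑' n : ℕ, schreierNorm F (intervalProj (k.1 n) (k.1 (n + 1)) x) ^ p :=
    tsum_nonneg fun n => Real.rpow_nonneg (schreierNorm_nonneg F _) _
  simp_rw [intervalProj_smul, schreierNorm_smul,
    Real.mul_rpow (abs_nonneg c) (schreierNorm_nonneg F _)]
  rw [tsum_mul_left, Real.mul_rpow (Real.rpow_nonneg (abs_nonneg c) p) h0,
    ← Real.rpow_mul (abs_nonneg c), mul_one_div_cancel (by linarith : p ≠ 0), Real.rpow_one]

/-- The norm of `(X_F)^{ℓ_p}` on `c₀₀`, as a seminorm. (It is a norm as soon as `F` contains all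
singletons, as the Schreier families do.) -/
def baernsteinSeminorm (F : Set (Finset ℕ+)) (p : ℝ) (hp : 1 ≤ p) : Seminorm ℝ (ℕ+ →₀ ℝ) :=
  Seminorm.of (baernsteinNorm F p) (baernsteinNorm_add_le F hp)
    (fun c x => by rw [Real.norm_eq_abs]; exact baernsteinNorm_smul F hp c x)

/-! ### The Baernstein space -/

/-- A copy of `c₀₀`, to be normed by `baernsteinNorm F p`. -/
def PreSpace (_F : Set (Finset ℕ+)) (p : ℝ) (_hp : 1 ≤ p) : Type := ℕ+ →₀ ℝ

instance (F : Set (Finset ℕ+)) (p : ℝ) (hp : 1 ≤ p) :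
    SeminormedAddCommGroup (PreSpace F p hp) :=
  (baernsteinSeminorm F p hp).toAddGroupSeminorm.toSeminormedAddCommGroup

instance (F : Set (Finset ℕ+)) (p : ℝ) (hp : 1 ≤ p) : NormedSpace ℝ (PreSpace F p hp) where
  toModule := inferInstanceAs (Module ℝ (ℕ+ →₀ ℝ))
  norm_smul_le c x := (baernsteinNorm_smul F hp c x).le

/-- The identity map from `c₀₀` to its normed copy. -/
def PreSpace.of (F : Set (Finset ℕ+)) (p : ℝ) (hp : 1 ≤ p) (x : ℕ+ →₀ ℝ) : PreSpace F p hp := x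

theorem PreSpace.norm_of (F : Set (Finset ℕ+)) (p : ℝ) (hp : 1 ≤ p) (x : ℕ+ →₀ ℝ) :
    ‖PreSpace.of F p hp x‖ = baernsteinNorm F p x := rfl

/-- The completion of `c₀₀` in the norm `baernsteinNorm F p`. For `F = S_α` this is the
Baernstein space `X^p_α` of order `α` and parameter `p`. -/
abbrev Space (F : Set (Finset ℕ+)) (p : ℝ) (hp : 1 ≤ p) : Type :=
  UniformSpace.Completion (PreSpace F p hp)

/-- The unit vectors `eₙ`. -/
def unitVector (F : Set (Finset ℕ+)) (p : ℝ) (hp : 1 ≤ p) (n : ℕ+) : Space F p hp :=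
  ((PreSpace.of F p hp (Finsupp.single n 1) : PreSpace F p hp) : Space F p hp)

/-! ### Bases -/

section Bases

/-- Schauder bases `(eₙ)_{n ≥ 1}`: every `x` is the limit of the partial sums
`∑_{i ≤ n} e_i^*(x) e_i`, with `(e_i^*)` the continuous coordinate functionals. -/
abbrev Basis (X : Type*) [NormedAddCommGroup X] [NormedSpace ℝ X] : Type _ :=
  GeneralSchauderBasis ℕ+ ℝ X (SummationFilter.conditional ℕ+)

variable {X U : Type*} [NormedAddCommGroup X] [NormedSpace ℝ X]
  [NormedAddCommGroup U] [NormedSpace ℝ U]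

/-- `1`-unconditional: changing signs of coefficients does not change the norm. -/
def OneUnconditional (e : ℕ+ → X) : Prop :=
  ∀ (a : ℕ+ →₀ ℝ) (s : ℕ+ → ℝ), (∀ i, |s i| = 1) →
    ‖a.sum fun i t => (s i * t) • e i‖ = ‖a.sum fun i t => t • e i‖

/-- Shrinking: the closed linear span of the coordinate functionals is the whole dual. -/
def Shrinking (b : Basis X) : Prop :=
  (Submodule.span ℝ (Set.range b.coord)).topologicalClosure = ⊤

/-- Boundedly complete: if the partial sums of `∑ cₙ eₙ` are bounded, the series converges. -/
def BoundedlyComplete (b : Basis X) : Prop :=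
  ∀ c : ℕ+ → ℝ, BddAbove (Set.range fun N : ℕ+ => ‖∑ i ∈ Finset.Icc 1 N, c i • b i‖) →
    ∃ x : X, Tendsto (fun N : ℕ+ => ∑ i ∈ Finset.Icc 1 N, c i • b i) atTop (𝓝 x)

/-- `(xₙ)` is `C`-dominated by `(yₙ)`. -/
def DominatedBy (C : ℝ) (x : ℕ → X) (y : ℕ → U) : Prop :=
  ∀ a : ℕ →₀ ℝ, ‖a.sum fun n t => t • x n‖ ≤ C * ‖a.sum fun n t => t • y n‖

/-- `R`-right dominant: `(u_{mₙ})` is `R`-dominated by `(u_{kₙ})` for all subsequences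
`(mₙ)`, `(kₙ)` of the natural numbers with `mₙ ≤ kₙ` for all `n`. -/
def RightDominant (R : ℝ) (u : ℕ+ → X) : Prop :=
  ∀ m k : ℕ → ℕ+, StrictMono m → StrictMono k → (∀ n, m n ≤ k n) →
    DominatedBy R (fun n => u (m n)) (fun n => u (k n))

/-- The support of a vector with respect to a basis. -/
def supp (b : Basis X) (x : X) : Set ℕ+ := {n | b.coord n x ≠ 0}

/-- A normalized block sequence: unit vectors with finite, successive supports. -/
structure IsNormalizedBlockSequence (b : Basis X) (z : ℕ → X) : Prop where
  norm_eq_one : ∀ n, ‖z n‖ = 1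
  finite_supp : ∀ n, (supp b (z n)).Finite
  successive : ∀ n, ∀ i ∈ supp b (z n), ∀ j ∈ supp b (z (n + 1)), i < j

/-- Subsequential `C`-`U`-upper block estimates: every normalized block sequence `(zₙ)` of the
basis `b` is `C`-dominated by `(u_{mₙ})`, where `mₙ = min supp zₙ`. -/
def UpperBlockEstimates (C : ℝ) (b : Basis X) (u : ℕ+ → U) : Prop :=
  ∀ (z : ℕ → X) (m : ℕ → ℕ+), IsNormalizedBlockSequence b z →
    (∀ n, IsLeast (supp b (z n)) (m n)) → DominatedBy C z (fun n => u (m n))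

end Bases

end Baernstein

end

/-!
The Schreier families are closed under subsets and under moving elements to the right, and they
have small averages: every infinite set carries convex combinations of unit vectors whose Schreier
norm is as small as desired. By transfinite induction small averages survive the passage to
`S_{α+1}` and to limits, and the theorem holds for every family with these three properties.

Let `(z_j)` be a block sequence of vectors of norm at most one with left endpoints `m_j`. If the
leftmost block met by a set `E` of the family is dropped, the left endpoints of the other blocks
met by `E` lie to the right of elements of `E`, so they form a set of the family again; the dropped
block costs a second copy of the norm, and `∑ a_j z_j` is `2`-dominated by `∑ a_j e_{m_j}` in the
Schreier norm. For the Baernstein norm, an interval `[k_n, k_{n+1})` sees in addition at most one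
block that starts to its left. These blocks contribute an `ℓ_p` sum of the `a_j`, whence the
constant `3`.

A functional whose tails do not tend to zero would be bounded below on the convex combinations of
a block sequence, and by the upper estimate some of these are arbitrarily small; so the basis is
shrinking. Bounded completeness follows from the lower estimate `‖x‖ ^ p + ‖y‖ ^ p ≤ ‖x + y‖ ^ p`
for `x < y`.
-/

noncomputable section

namespace Baernstein

open Filter Topology Convexity

/-! ### Spreading families -/

section Spreading

variable {F G : Set (Finset ℕ+)} {m k : ℕ → ℕ+} {z : ℕ → ℕ+ →₀ ℝ}

theorem le_schreierNorm {E : Finset ℕ+} (hE : E ∈ F) (x : ℕ+ →₀ ℝ) :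
    ∑ i ∈ E, |x i| ≤ schreierNorm F x :=
  le_ciSup (schreier_bddAbove F x) ⟨E, hE⟩

theorem schreierNorm_le_of_forall {x : ℕ+ →₀ ℝ} {C : ℝ} (hC : 0 ≤ C)
    (h : ∀ E ∈ F, ∑ i ∈ E, |x i| ≤ C) : schreierNorm F x ≤ C :=
  Real.iSup_le (fun E => h E.1 E.2) hC

theorem schreierNorm_mono {x y : ℕ+ →₀ ℝ} (h : ∀ i, |x i| ≤ |y i|) :
    schreierNorm F x ≤ schreierNorm F y :=
  schreierNorm_le_of_forall (schreierNorm_nonneg F y) fun _ hE =>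
    (Finset.sum_le_sum fun i _ => h i).trans (le_schreierNorm hE y)

theorem schreierNorm_mono_family (h : F ⊆ G) (x : ℕ+ →₀ ℝ) :
    schreierNorm F x ≤ schreierNorm G x :=
  schreierNorm_le_of_forall (schreierNorm_nonneg G x) fun _ hE => le_schreierNorm (h hE) x

theorem schreierNorm_add_le_max {x y : ℕ+ →₀ ℝ} {δ : ℝ} (hδ : 0 ≤ δ)
    (h : ∀ E ∈ F, (∃ i ∈ E, x i ≠ 0) → ∑ i ∈ E, |y i| ≤ δ) :
    schreierNorm F (x + y) ≤ max (schreierNorm F x + δ) (schreierNorm F y) := by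
  have hx := schreierNorm_nonneg F x
  refine schreierNorm_le_of_forall (le_max_of_le_left (by positivity)) fun E hE => ?_
  by_cases hEx : ∃ i ∈ E, x i ≠ 0
  · refine le_max_of_le_left ?_
    calc ∑ i ∈ E, |(x + y) i| ≤ ∑ i ∈ E, |x i| + ∑ i ∈ E, |y i| := by
          rw [← Finset.sum_add_distrib]
          exact Finset.sum_le_sum fun i _ => abs_add_le _ _
      _ ≤ schreierNorm F x + δ := add_le_add (le_schreierNorm hE x) (h E hE hEx)
  · push Not at hEx
    refine le_max_of_le_right ((Finset.sum_le_sum fun i hi => ?_).trans (le_schreierNorm hE y))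
    rw [Finsupp.add_apply, hEx i hi, zero_add]

/-- A hereditary family of finite sets which contains all singletons and is closed under
spreading: moving the elements of a member to the right, without collisions and in the same
order, gives a member. -/
structure IsSpreading (F : Set (Finset ℕ+)) : Prop where
  isLowerSet : IsLowerSet F
  singleton_mem : ∀ i, {i} ∈ F
  image_mem : ∀ E ∈ F, ∀ f : ℕ+ → ℕ+, StrictMonoOn f E → (∀ i ∈ E, i ≤ f i) → E.image f ∈ F

theorem IsSpreading.image_mem_of_le (hF : IsSpreading F) {B : Finset ℕ}
    (hm : StrictMonoOn m B) (hk : StrictMonoOn k B) (hmk : ∀ j ∈ B, m j ≤ k j)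
    (hB : B.image m ∈ F) : B.image k ∈ F := by
  have hinv : ∀ j ∈ B, Function.invFunOn m B (m j) = j := hm.injOn.leftInvOn_invFunOn
  have himage : B.image k = (B.image m).image (k ∘ Function.invFunOn m B) := by
    rw [Finset.image_image]
    exact Finset.image_congr fun j hj => by simp [hinv j hj]
  rw [himage]
  refine hF.image_mem _ hB _ ?_ ?_
  · simp only [Finset.coe_image]
    rintro _ ⟨i, hi, rfl⟩ _ ⟨j, hj, rfl⟩ hij
    simpa only [Function.comp_apply, hinv i hi, hinv j hj] using
      hk hi hj ((hm.lt_iff_lt hi hj).1 hij)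
  · rintro _ hi
    obtain ⟨j, hj, rfl⟩ := Finset.mem_image.1 hi
    simpa only [Function.comp_apply, hinv j hj] using hmk j hj

theorem sum_image_abs_mapDomain (hm : Function.Injective m) (B : Finset ℕ) (a : ℕ →₀ ℝ) :
    ∑ i ∈ B.image m, |a.mapDomain m i| = ∑ j ∈ B, |a j| := by
  rw [Finset.sum_image hm.injOn]
  simp only [Finsupp.mapDomain_apply hm]

theorem IsSpreading.schreierNorm_mapDomain_le (hF : IsSpreading F) (hm : StrictMono m)
    (hk : StrictMono k) (hmk : ∀ j, m j ≤ k j) (a : ℕ →₀ ℝ) :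
    schreierNorm F (a.mapDomain m) ≤ schreierNorm F (a.mapDomain k) := by
  refine schreierNorm_le_of_forall (schreierNorm_nonneg F _) fun E hE => ?_
  set B := E.preimage m hm.injective.injOn
  have hBE : B.image m ⊆ E := Finset.image_subset_iff.2 fun j hj => Finset.mem_preimage.1 hj
  have hBk : B.image k ∈ F := hF.image_mem_of_le (hm.strictMonoOn _) (hk.strictMonoOn _)
    (fun j _ => hmk j) (hF.isLowerSet hBE hE)
  calc ∑ i ∈ E, |a.mapDomain m i| = ∑ j ∈ B, |a.mapDomain m (m j)| :=
        (Finset.sum_preimage m E _ (fun i => |a.mapDomain m i|) fun i _ hi => by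
          rw [Finsupp.mapDomain_of_notMem_range _ _ hi, abs_zero]).symm
    _ = ∑ i ∈ B.image k, |a.mapDomain k i| := by
        simp only [sum_image_abs_mapDomain hk.injective, Finsupp.mapDomain_apply hm.injective]
    _ ≤ schreierNorm F (a.mapDomain k) := le_schreierNorm hBk _

/-- Successive finitely supported vectors: `z j` is supported in `[m j, m (j + 1))`. -/
structure BlocksAt (m : ℕ → ℕ+) (z : ℕ → ℕ+ →₀ ℝ) : Prop where
  strictMono : StrictMono m
  support_subset : ∀ j, ((z j).support : Set ℕ+) ⊆ Set.Ico (m j) (m (j + 1))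

theorem IsSpreading.image_erase_min_mem (hF : IsSpreading F) (hm : StrictMono m)
    {E : Finset ℕ+} (hE : E ∈ F) {B : Finset ℕ} (hB : B.Nonempty)
    (h : ∀ j ∈ B, ∃ i ∈ E, i ∈ Set.Ico (m j) (m (j + 1))) :
    (B.erase (B.min' hB)).image m ∈ F := by
  -- Each left endpoint is a spread of the last element of `E` before it.
  set u : ℕ → ℕ+ := fun j => (E.filter (· < m j)).sup id with hu
  have mem_filter : ∀ i ∈ B, ∀ j, i < j → ∃ l ∈ E.filter (· < m j), m i ≤ l := by
    intro i hi j hij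
    obtain ⟨l, hlE, hil, hli⟩ := h i hi
    exact ⟨l, Finset.mem_filter.2 ⟨hlE, hli.trans_le (hm.monotone hij)⟩, hil⟩
  have u_mem : ∀ j ∈ B.erase (B.min' hB), u j ∈ E.filter (· < m j) := by
    intro j hj
    obtain ⟨l, hl, _⟩ :=
      mem_filter _ (B.min'_mem hB) j (B.min'_lt_of_mem_erase_min' hB hj)
    obtain ⟨i, hi, hui⟩ := Finset.exists_mem_eq_sup _ ⟨l, hl⟩ id
    simpa only [hu, hui, id] using hi
  have u_lt : ∀ j ∈ B.erase (B.min' hB), u j < m j := fun j hj =>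
    (Finset.mem_filter.1 (u_mem j hj)).2
  refine hF.image_mem_of_le (m := u) ?_ (hm.strictMonoOn _) (fun j hj => (u_lt j hj).le) ?_
  · intro i hi j _ hij
    obtain ⟨l, hl, hil⟩ := mem_filter i (Finset.mem_of_mem_erase hi) j hij
    exact (u_lt i hi).trans_le (hil.trans (Finset.le_sup (f := id) hl))
  · refine hF.isLowerSet (Finset.image_subset_iff.2 fun j hj => ?_) hE
    exact (Finset.mem_filter.1 (u_mem j hj)).1

theorem IsSpreading.sum_abs_le_two_mul_schreierNorm (hF : IsSpreading F) (hm : StrictMono m)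
    {E : Finset ℕ+} (hE : E ∈ F) {B : Finset ℕ}
    (h : ∀ j ∈ B, ∃ i ∈ E, i ∈ Set.Ico (m j) (m (j + 1))) (a : ℕ →₀ ℝ) :
    ∑ j ∈ B, |a j| ≤ 2 * schreierNorm F (a.mapDomain m) := by
  rcases B.eq_empty_or_nonempty with rfl | hB
  · simpa using schreierNorm_nonneg F (a.mapDomain m)
  have hfirst : |a (B.min' hB)| ≤ schreierNorm F (a.mapDomain m) := by
    simpa [Finsupp.mapDomain_apply hm.injective] using
      le_schreierNorm (hF.singleton_mem (m (B.min' hB))) (a.mapDomain m)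
  have hrest : ∑ j ∈ B.erase (B.min' hB), |a j| ≤ schreierNorm F (a.mapDomain m) := by
    rw [← sum_image_abs_mapDomain hm.injective]
    exact le_schreierNorm (hF.image_erase_min_mem hm hE hB h) _
  rw [← Finset.add_sum_erase _ _ (B.min'_mem hB)]
  linarith

theorem sum_abs_linearCombination_le (z : ℕ → ℕ+ →₀ ℝ) (a : ℕ →₀ ℝ) (E : Finset ℕ+) :
    ∑ i ∈ E, |Finsupp.linearCombination ℝ z a i| ≤ ∑ j ∈ a.support, |a j| * ∑ i ∈ E, |z j i| := by
  simp only [Finset.mul_sum]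
  rw [Finset.sum_comm]
  refine Finset.sum_le_sum fun i _ => ?_
  rw [Finsupp.linearCombination_apply, Finsupp.sum, Finsupp.finsetSum_apply]
  refine (Finset.abs_sum_le_sum_abs _ _).trans_eq (Finset.sum_congr rfl fun j _ => ?_)
  rw [Finsupp.smul_apply, smul_eq_mul, abs_mul]

theorem BlocksAt.schreierNorm_linearCombination_le (hz : BlocksAt m z) (hF : IsSpreading F)
    (hz1 : ∀ j, schreierNorm F (z j) ≤ 1) (a : ℕ →₀ ℝ) :
    schreierNorm F (Finsupp.linearCombination ℝ z a) ≤ 2 * schreierNorm F (a.mapDomain m) := by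
  have hnonneg := schreierNorm_nonneg F (a.mapDomain m)
  refine schreierNorm_le_of_forall (by positivity) fun E hE => ?_
  set B := a.support.filter fun j => ∃ i ∈ E, i ∈ Set.Ico (m j) (m (j + 1))
  calc ∑ i ∈ E, |Finsupp.linearCombination ℝ z a i|
      ≤ ∑ j ∈ a.support, |a j| * ∑ i ∈ E, |z j i| := sum_abs_linearCombination_le z a E
    _ = ∑ j ∈ B, |a j| * ∑ i ∈ E, |z j i| := by
        refine (Finset.sum_subset (Finset.filter_subset _ _) fun j hj hjB => ?_).symm
        rw [Finset.sum_eq_zero, mul_zero]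
        refine fun i hi => abs_eq_zero.2 (Finsupp.notMem_support_iff.1 fun hzi => hjB ?_)
        exact Finset.mem_filter.2 ⟨hj, i, hi, hz.support_subset j hzi⟩
    _ ≤ ∑ j ∈ B, |a j| := Finset.sum_le_sum fun j _ =>
        mul_le_of_le_one_right (abs_nonneg _) ((le_schreierNorm hE _).trans (hz1 j))
    _ ≤ 2 * schreierNorm F (a.mapDomain m) :=
        hF.sum_abs_le_two_mul_schreierNorm hz.strictMono hE
          (fun j hj => (Finset.mem_filter.1 hj).2) a

end Spreading

/-! ### Small averages -/

section SmallAverages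

variable {F G : Set (Finset ℕ+)} {m : ℕ → ℕ+}

/-- Every infinite set supports probability vectors of arbitrarily small Schreier norm. This form
of Pták's lemma takes the place of the compactness of the family. -/
def HasSmallAverages (F : Set (Finset ℕ+)) : Prop :=
  ∀ M : Set ℕ+, M.Infinite → ∀ ε : ℝ, 0 < ε →
    ∃ a : StdSimplex ℝ ℕ+, (a.weights.support : Set ℕ+) ⊆ M ∧ schreierNorm F a.weights ≤ ε

/-- The properties of the Schreier families on which the theory of Baernstein spaces rests. -/
structure IsRegular (F : Set (Finset ℕ+)) : Prop extends IsSpreading F where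
  hasSmallAverages : HasSmallAverages F

theorem HasSmallAverages.mono (hG : HasSmallAverages G) (h : F ⊆ G) : HasSmallAverages F :=
  fun M hM ε hε =>
    let ⟨a, haM, ha⟩ := hG M hM ε hε
    ⟨a, haM, (schreierNorm_mono_family h _).trans ha⟩

theorem sum_abs_weights_le_one (a : StdSimplex ℝ ℕ+) (E : Finset ℕ+) :
    ∑ i ∈ E, |a.weights i| ≤ 1 :=
  (sum_abs_le E a.weights).trans_eq <| by
    simpa only [abs_of_nonneg (a.weights_nonneg _), Finsupp.sum] using a.total

theorem schreierNorm_weights_le_one (F : Set (Finset ℕ+)) (a : StdSimplex ℝ ℕ+) :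
    schreierNorm F a.weights ≤ 1 :=
  schreierNorm_le_of_forall zero_le_one fun E _ => sum_abs_weights_le_one a E

theorem schreierNorm_linearCombination_weights_le (b : StdSimplex ℝ ℕ) {z : ℕ → ℕ+ →₀ ℝ} {C : ℝ}
    (hC : 0 ≤ C) (hz : ∀ j, schreierNorm F (z j) ≤ C) :
    schreierNorm F (Finsupp.linearCombination ℝ z b.weights) ≤ C := by
  refine schreierNorm_le_of_forall hC fun E hE => ?_
  calc ∑ i ∈ E, |Finsupp.linearCombination ℝ z b.weights i|
      ≤ ∑ j ∈ b.weights.support, |b.weights j| * ∑ i ∈ E, |z j i| :=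
        sum_abs_linearCombination_le z b.weights E
    _ ≤ ∑ j ∈ b.weights.support, |b.weights j| * C := by
        gcongr with j
        exact (le_schreierNorm hE _).trans (hz j)
    _ = C := by
        simp only [abs_of_nonneg (b.weights_nonneg _)]
        rw [← Finset.sum_mul, show ∑ j ∈ b.weights.support, b.weights j = 1 from b.total, one_mul]

theorem HasSmallAverages.exists_schreierNorm_mapDomain_le (hF : HasSmallAverages F)
    (hm : Function.Injective m) {ε : ℝ} (hε : 0 < ε) :
    ∃ b : StdSimplex ℝ ℕ, schreierNorm F (b.weights.mapDomain m) ≤ ε := by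
  obtain ⟨a, ha, haε⟩ := hF _ (Set.infinite_range_of_injective hm) ε hε
  have hmap : (a.weights.comapDomain m hm.injOn).mapDomain m = a.weights :=
    Finsupp.mapDomain_comapDomain m hm _ ha
  refine ⟨⟨a.weights.comapDomain m hm.injOn, fun j => a.weights_nonneg (m j), ?_⟩, ?_⟩
  · rw [← a.total, ← hmap, Finsupp.sum_mapDomain_index (fun _ => rfl) fun _ _ _ => rfl, hmap]
  · rwa [hmap]

theorem exists_blocksAt {P : (ℕ+ →₀ ℝ) → Prop}
    (h : ∀ K : ℕ+, ∃ x : ℕ+ →₀ ℝ, (x.support : Set ℕ+) ⊆ Set.Ici K ∧ P x) :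
    ∃ (m : ℕ → ℕ+) (z : ℕ → ℕ+ →₀ ℝ), BlocksAt m z ∧ ∀ j, P (z j) := by
  choose g hgK hgP using h
  let K : ℕ → ℕ+ := fun j => j.rec 1 fun _ L => max L ((g L).support.sup id) + 1
  have hK : ∀ j, K (j + 1) = max (K j) ((g (K j)).support.sup id) + 1 := fun _ => rfl
  refine ⟨K, fun j => g (K j), ⟨strictMono_nat_of_lt_succ fun j => ?_, fun j i hi => ?_⟩,
    fun j => hgP (K j)⟩
  · exact hK j ▸ PNat.lt_add_one_iff.2 (le_max_left _ _)
  · refine ⟨hgK _ hi, hK j ▸ PNat.lt_add_one_iff.2 (le_max_of_le_right ?_)⟩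
    exact Finset.le_sup (f := id) (Finset.mem_coe.1 hi)

theorem infinite_inter_Ici {M : Set ℕ+} (hM : M.Infinite) (K : ℕ+) :
    (M ∩ Set.Ici K).Infinite := by
  rw [← Set.compl_Iio, ← Set.sdiff_eq]
  exact hM.sdiff (Set.finite_Iio K)

theorem HasSmallAverages.union (hF : HasSmallAverages F) (hG : IsRegular G) :
    HasSmallAverages (F ∪ G) := by
  intro M hM ε hε
  obtain ⟨m, z, hz, hzP⟩ := exists_blocksAt
    (P := fun x => ∃ a : StdSimplex ℝ ℕ+, a.weights = x ∧ (x.support : Set ℕ+) ⊆ M ∧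
      schreierNorm F x ≤ ε) fun K =>
    let ⟨a, haM, haε⟩ := hF _ (infinite_inter_Ici hM K) ε hε
    ⟨a.weights, fun _ hi => (haM hi).2, a, rfl, fun _ hi => (haM hi).1, haε⟩
  choose a ha hzM hzε using hzP
  obtain ⟨b, hb⟩ := hG.hasSmallAverages.exists_schreierNorm_mapDomain_le hz.strictMono.injective
    (half_pos hε)
  have hweights : (b.iConvexComb a).weights = Finsupp.linearCombination ℝ z b.weights := by
    simp only [iConvexComb, StdSimplex.weights_sConvexComb, StdSimplex.weights_map,
      Finsupp.sum_mapDomain_index, zero_smul, add_smul, implies_true,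
      Finsupp.linearCombination_apply, ha]
  refine ⟨b.iConvexComb a, ?_, schreierNorm_le_of_forall hε.le ?_⟩
  · rw [hweights, Finsupp.linearCombination_apply]
    intro i hi
    obtain ⟨j, _, hj⟩ := Finset.mem_biUnion.1 (Finsupp.support_sum hi)
    exact hzM j (Finsupp.support_smul hj)
  · rintro E (hE | hE)
    · rw [hweights]
      exact (le_schreierNorm hE _).trans (schreierNorm_linearCombination_weights_le b hε.le hzε)
    · rw [hweights]
      have hdom := hz.schreierNorm_linearCombination_le hG.toIsSpreading
        (fun j => ha j ▸ schreierNorm_weights_le_one G (a j)) b.weights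
      linarith [le_schreierNorm hE (Finsupp.linearCombination ℝ z b.weights)]

theorem HasSmallAverages.biUnion {F : ℕ+ → Set (Finset ℕ+)} (hF : ∀ n, IsRegular (F n))
    (s : Finset ℕ+) : HasSmallAverages (⋃ n ∈ s, F n) := by
  induction s using Finset.induction_on with
  | empty => exact (hF 1).hasSmallAverages.mono (by simp)
  | insert n s _ ih =>
    rw [Finset.set_biUnion_insert, Set.union_comm]
    exact ih.union (hF n)

theorem exists_schreierNorm_weights_le_inv_add
    (h : ∀ K : ℕ+, HasSmallAverages {E ∈ F | ∃ i ∈ E, i ≤ K}) {M : Set ℕ+} (hM : M.Infinite)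
    {ε : ℝ} (hε : 0 < ε) (N : ℕ) :
    ∃ a : StdSimplex ℝ ℕ+, (a.weights.support : Set ℕ+) ⊆ M ∧
      schreierNorm F a.weights ≤ ((N : ℝ) + 1)⁻¹ + ε := by
  induction N with
  | zero =>
    obtain ⟨i, hi⟩ := hM.nonempty
    refine ⟨.single i, fun j hj => ?_, (schreierNorm_weights_le_one F _).trans (by simp [hε.le])⟩
    rwa [Finset.mem_singleton.1 (Finsupp.support_single_subset hj)]
  | succ N ih =>
    obtain ⟨a, haM, ha⟩ := ih
    set K := a.weights.support.sup id
    obtain ⟨b, hbM, hb⟩ := h K M hM ε hε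
    set s : ℝ := (N + 1) / (N + 2)
    set t : ℝ := (N + 2)⁻¹
    have hs : 0 ≤ s := by positivity
    have ht : 0 ≤ t := by positivity
    have hst : s + t = 1 := by simp only [s, t]; field_simp; ring
    have hsN : s * ((N : ℝ) + 1)⁻¹ = t := by simp only [s, t]; field_simp
    refine ⟨convexCombPair s t hs ht hst a b, ?_, ?_⟩
    · rw [StdSimplex.weights_convexCombPair]
      intro i hi
      rcases Finset.mem_union.1 (Finsupp.support_add hi) with hi | hi
      · exact haM (Finsupp.support_smul hi)
      · exact hbM (Finsupp.support_smul hi)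
    · have hinitial : ∀ E ∈ F, (∃ i ∈ E, (s • a.weights) i ≠ 0) →
          ∑ i ∈ E, |(t • b.weights) i| ≤ t * ε := by
        rintro E hE ⟨i, hi, hai⟩
        have hiK : i ≤ K := Finset.le_sup (f := id) (Finsupp.mem_support_iff.2
          (right_ne_zero_of_mul hai))
        simp only [Finsupp.smul_apply, smul_eq_mul, abs_mul, abs_of_nonneg ht, ← Finset.mul_sum]
        gcongr
        exact (le_schreierNorm (F := {E ∈ F | ∃ i ∈ E, i ≤ K}) ⟨hE, i, hi, hiK⟩ _).trans hb
      have hcast : (((N + 1 : ℕ) : ℝ) + 1)⁻¹ = t := by simp only [t]; push_cast; ring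
      rw [StdSimplex.weights_convexCombPair, hcast]
      refine (schreierNorm_add_le_max (by positivity) hinitial).trans (max_le ?_ ?_)
      · rw [schreierNorm_smul, abs_of_nonneg hs]
        calc s * schreierNorm F a.weights + t * ε
            ≤ s * (((N : ℝ) + 1)⁻¹ + ε) + t * ε := by gcongr
          _ = t + ε := by rw [mul_add, hsN, add_assoc, ← add_mul, hst, one_mul]
      · rw [schreierNorm_smul, abs_of_nonneg ht]
        linarith [mul_le_of_le_one_right ht (schreierNorm_weights_le_one F b)]

theorem HasSmallAverages.of_forall_initial
    (h : ∀ K : ℕ+, HasSmallAverages {E ∈ F | ∃ i ∈ E, i ≤ K}) : HasSmallAverages F := by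
  intro M hM ε hε
  obtain ⟨N, hN⟩ := exists_nat_one_div_lt (half_pos hε)
  obtain ⟨a, haM, ha⟩ := exists_schreierNorm_weights_le_inv_add h hM (half_pos hε) N
  refine ⟨a, haM, ha.trans ?_⟩
  rw [one_div] at hN
  linarith

end SmallAverages

/-! ### Regularity of the Schreier families -/

section Regularity

variable {S : Set (Finset ℕ+)} {F : ℕ+ → Set (Finset ℕ+)}

theorem isSpreading_card_le_one : IsSpreading {E : Finset ℕ+ | E.card ≤ 1} where
  isLowerSet _ _ hDE hE := (Finset.card_le_card hDE).trans hE
  singleton_mem i := (Finset.card_singleton i).le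
  image_mem _ hE _ _ _ := Finset.card_image_le.trans hE

theorem hasSmallAverages_card_le_one : HasSmallAverages {E : Finset ℕ+ | E.card ≤ 1} := by
  refine .of_forall_initial fun K M hM ε hε => ?_
  obtain ⟨n, hnM, hnK⟩ := (infinite_inter_Ici hM (K + 1)).nonempty
  refine ⟨.single n, fun j hj => ?_, schreierNorm_le_of_forall hε.le ?_⟩
  · rwa [Finset.mem_singleton.1 (Finsupp.support_single_subset hj)]
  · rintro E ⟨hE, i, hi, hiK⟩
    refine (Finset.sum_eq_zero fun j hj => ?_).trans_le hε.le
    have hjn : j ≠ n := by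
      rw [Finset.card_le_one.1 hE j hj i hi]
      exact ((PNat.lt_add_one_iff.2 hiK).trans_le hnK).ne
    rw [StdSimplex.weights_single, Finsupp.single_eq_of_ne hjn, abs_zero]

theorem isRegular_card_le_one : IsRegular {E : Finset ℕ+ | E.card ≤ 1} :=
  ⟨isSpreading_card_le_one, hasSmallAverages_card_le_one⟩

theorem IsSpreading.schreierSucc (hS : IsSpreading S) : IsSpreading (schreierSucc S) where
  isLowerSet := by
    rintro _ E' hE' ⟨n, D, hD, hlt, hn, rfl⟩
    refine ⟨n, fun k => E' ∩ D k, fun k => hS.isLowerSet Finset.inter_subset_right (hD k),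
      fun k l hkl i hi j hj => hlt k l hkl i (Finset.mem_of_mem_inter_right hi) j
        (Finset.mem_of_mem_inter_right hj), fun i hi => hn i (hE' hi), ?_⟩
    rw [← Finset.inter_biUnion, Finset.inter_eq_left.2 hE']
  singleton_mem i := ⟨1, fun _ => {i}, fun _ => hS.singleton_mem i,
    fun k l hkl => absurd (Subsingleton.elim k l) hkl.ne, fun j _ => j.pos, by simp⟩
  image_mem := by
    rintro _ ⟨n, D, hD, hlt, hn, rfl⟩ f hf hle
    have hsub : ∀ k, D k ⊆ Finset.univ.biUnion D := fun k =>
      Finset.subset_biUnion_of_mem D (Finset.mem_univ k)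
    refine ⟨n, fun k => (D k).image f, fun k => hS.image_mem _ (hD k) f
      (hf.mono (Finset.coe_subset.2 (hsub k))) fun i hi => hle i (hsub k hi), ?_, ?_,
      Finset.biUnion_image⟩
    · intro k l hkl
      simp only [SetLT, Finset.forall_mem_image]
      exact fun i hi j hj => hf (hsub k hi) (hsub l hj) (hlt k l hkl i hi j hj)
    · rw [Finset.forall_mem_image]
      exact fun i hi => (hn i hi).trans (hle i hi)

theorem SetLT.disjoint {E F : Finset ℕ+} (h : SetLT E F) : Disjoint E F :=
  Finset.disjoint_left.2 fun i hi hi' => (h i hi i hi').false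

theorem HasSmallAverages.schreierSucc (hS : HasSmallAverages S) :
    HasSmallAverages (schreierSucc S) := by
  -- A member starting before `K` is a union of at most `K` members of `S`.
  refine .of_forall_initial fun K M hM ε hε => ?_
  have hK : (0 : ℝ) < (K : ℕ) := by exact_mod_cast K.pos
  obtain ⟨a, haM, ha⟩ := hS M hM (ε / (K : ℕ)) (by positivity)
  refine ⟨a, haM, schreierNorm_le_of_forall hε.le ?_⟩
  rintro _ ⟨⟨n, D, hD, hlt, hn, rfl⟩, i, hi, hiK⟩
  have hnK : n ≤ (K : ℕ) := (hn i hi).trans hiK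
  calc ∑ i ∈ Finset.univ.biUnion D, |a.weights i| = ∑ k, ∑ i ∈ D k, |a.weights i| :=
        Finset.sum_biUnion fun k _ l _ hkl => hkl.lt_or_gt.elim
          (fun h => (hlt k l h).disjoint) fun h => (hlt l k h).disjoint.symm
    _ ≤ ∑ _k : Fin n, ε / (K : ℕ) :=
        Finset.sum_le_sum fun k _ => (le_schreierNorm (hD k) _).trans ha
    _ = n * (ε / (K : ℕ)) := by
        rw [Finset.sum_const, Finset.card_univ, Fintype.card_fin, nsmul_eq_mul]
    _ ≤ (K : ℕ) * (ε / (K : ℕ)) := by gcongr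
    _ = ε := mul_div_cancel₀ _ hK.ne'

theorem IsRegular.schreierSucc (hS : IsRegular S) : IsRegular (schreierSucc S) :=
  ⟨hS.toIsSpreading.schreierSucc, hS.hasSmallAverages.schreierSucc⟩

theorem isSpreading_diagonal (hF : ∀ n, IsSpreading (F n)) :
    IsSpreading {E | ∃ n : ℕ+, (∀ i ∈ E, n ≤ i) ∧ E ∈ F n} where
  isLowerSet := by
    rintro E D hDE ⟨n, hn, hE⟩
    exact ⟨n, fun i hi => hn i (hDE hi), (hF n).isLowerSet hDE hE⟩
  singleton_mem i := ⟨1, fun j _ => one_le, (hF 1).singleton_mem i⟩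
  image_mem := by
    rintro E ⟨n, hn, hE⟩ f hf hle
    exact ⟨n, Finset.forall_mem_image.2 fun i hi => (hn i hi).trans (hle i hi),
      (hF n).image_mem E hE f hf hle⟩

theorem hasSmallAverages_diagonal (hF : ∀ n, IsRegular (F n)) :
    HasSmallAverages {E | ∃ n : ℕ+, (∀ i ∈ E, n ≤ i) ∧ E ∈ F n} := by
  refine .of_forall_initial fun K => (HasSmallAverages.biUnion hF (Finset.Iic K)).mono ?_
  rintro E ⟨⟨n, hn, hE⟩, i, hi, hiK⟩
  exact Set.mem_biUnion (Finset.mem_Iic.2 ((hn i hi).trans hiK)) hE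

theorem isRegular_diagonal (hF : ∀ n, IsRegular (F n)) :
    IsRegular {E | ∃ n : ℕ+, (∀ i ∈ E, n ≤ i) ∧ E ∈ F n} :=
  ⟨isSpreading_diagonal fun n => (hF n).toIsSpreading, hasSmallAverages_diagonal hF⟩

theorem IsLimitSystem.add_one_lt {a : Ordinal.{0} → ℕ+ → Ordinal.{0}} (ha : IsLimitSystem a)
    {l : Ordinal.{0}} (hl : Order.IsSuccLimit l) (hl1 : l < Ordinal.omega 1) (n : ℕ+) :
    a l n + 1 < l := by
  obtain ⟨hmono, hlub⟩ := ha l hl1 hl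
  exact hl.add_one_lt ((hmono (PNat.lt_add_right n 1)).trans_le (hlub.1 ⟨n + 1, rfl⟩))

theorem isRegular_schreierFamily {a : Ordinal.{0} → ℕ+ → Ordinal.{0}} (ha : IsLimitSystem a)
    {α : Ordinal.{0}} (hα : α < Ordinal.omega 1) : IsRegular (schreierFamily a α) := by
  induction α using Ordinal.limitRecOn with
  | zero => exact schreierFamily_zero a ▸ isRegular_card_le_one
  | add_one α ih =>
    rw [schreierFamily_add_one]
    exact (ih ((lt_add_one α).trans hα)).schreierSucc
  | limit l hl ih =>
    rw [schreierFamily_limit a ha l hl hα]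
    exact isRegular_diagonal fun n =>
      ih _ (ha.add_one_lt hl hα n) ((ha.add_one_lt hl hα n).trans hα)

end Regularity

/-! ### The Baernstein norm on finitely supported sequences -/

section BaernsteinNorm

variable {F : Set (Finset ℕ+)} {p : ℝ}

theorem intervalProj_apply (m n : ℕ+) (x : ℕ+ →₀ ℝ) (i : ℕ+) :
    intervalProj m n x i = if m ≤ i ∧ i < n then x i else 0 := by
  rw [intervalProj, Finsupp.filter_apply]

theorem intervalProj_self (m : ℕ+) (x : ℕ+ →₀ ℝ) : intervalProj m m x = 0 :=
  (Finsupp.filter_eq_zero_iff _ _).2 fun _ hi => absurd hi.1 (not_le.2 hi.2)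

theorem intervalProj_filter_lt (k l m : ℕ+) (x : ℕ+ →₀ ℝ) :
    intervalProj k l (x.filter (· < m)) = intervalProj (min k m) (min l m) x := by
  ext i
  simp only [intervalProj_apply, Finsupp.filter_apply, ← ite_and]
  grind

theorem intervalProj_filter_ge (k l m : ℕ+) (x : ℕ+ →₀ ℝ) :
    intervalProj k l (x.filter (m ≤ ·)) = intervalProj (max k m) (max l m) x := by
  ext i
  simp only [intervalProj_apply, Finsupp.filter_apply, ← ite_and]
  grind

theorem sum_rpow_le_of_strictMono (hp : 1 ≤ p) (x : ℕ+ →₀ ℝ) {k : ℕ → ℕ+} (hk : StrictMono k)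
    (T : ℕ) : ∑ t ∈ Finset.range T, schreierNorm F (intervalProj (k t) (k (t + 1)) x) ^ p ≤
      baernsteinNorm F p x ^ p := by
  have hnonneg : ∀ t, 0 ≤ schreierNorm F (intervalProj (k t) (k (t + 1)) x) ^ p := fun t =>
    Real.rpow_nonneg (schreierNorm_nonneg F _) _
  refine ((summable_blocks F hp x k hk).sum_le_tsum _ fun t _ => hnonneg t).trans ?_
  rw [← Real.rpow_inv_le_iff_of_pos (tsum_nonneg hnonneg) (baernsteinNorm_nonneg F p x)
    (by linarith), ← one_div]
  exact le_ciSup (baernstein_bddAbove F hp x) ⟨k, hk⟩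

theorem baernsteinNorm_le_of_forall (hp : 1 ≤ p) {x : ℕ+ →₀ ℝ} {C : ℝ} (hC : 0 ≤ C)
    (h : ∀ k : ℕ → ℕ+, StrictMono k → ∀ T : ℕ,
      ∑ t ∈ Finset.range T, schreierNorm F (intervalProj (k t) (k (t + 1)) x) ^ p ≤ C ^ p) :
    baernsteinNorm F p x ≤ C := by
  refine Real.iSup_le (fun k => ?_) hC
  have hnonneg : ∀ t, 0 ≤ schreierNorm F (intervalProj (k.1 t) (k.1 (t + 1)) x) ^ p := fun t =>
    Real.rpow_nonneg (schreierNorm_nonneg F _) _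
  rw [one_div, Real.rpow_inv_le_iff_of_pos (tsum_nonneg hnonneg) hC (by linarith)]
  exact Real.tsum_le_of_sum_range_le hnonneg (h k.1 k.2)

theorem baernsteinNorm_rpow_le_of_forall (hp : 1 ≤ p) {x : ℕ+ →₀ ℝ} {C : ℝ}
    (h : ∀ k : ℕ → ℕ+, StrictMono k → ∀ T : ℕ,
      ∑ t ∈ Finset.range T, schreierNorm F (intervalProj (k t) (k (t + 1)) x) ^ p ≤ C) :
    baernsteinNorm F p x ^ p ≤ C := by
  have hC : 0 ≤ C := by simpa using h Nat.succPNat (fun _ _ => Nat.succPNat_lt_succPNat.2) 0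
  rw [← Real.le_rpow_inv_iff_of_pos (baernsteinNorm_nonneg F p x) hC (by linarith)]
  refine baernsteinNorm_le_of_forall hp (by positivity) fun k hk T => ?_
  rw [Real.rpow_inv_rpow hC (by linarith)]
  exact h k hk T

theorem baernsteinNorm_mono (hp : 1 ≤ p) {x y : ℕ+ →₀ ℝ} (h : ∀ i, |x i| ≤ |y i|) :
    baernsteinNorm F p x ≤ baernsteinNorm F p y :=
  baernsteinNorm_le_of_forall hp (baernsteinNorm_nonneg F p y) fun k hk T => by
    refine (Finset.sum_le_sum fun t _ => ?_).trans (sum_rpow_le_of_strictMono hp y hk T)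
    refine Real.rpow_le_rpow (schreierNorm_nonneg F _) (schreierNorm_mono fun i => ?_)
      (by linarith)
    rw [intervalProj_apply, intervalProj_apply]
    split_ifs
    exacts [h i, le_rfl]

theorem baernsteinNorm_filter_le (hp : 1 ≤ p) (x : ℕ+ →₀ ℝ) (P : ℕ+ → Prop) [DecidablePred P] :
    baernsteinNorm F p (x.filter P) ≤ baernsteinNorm F p x :=
  baernsteinNorm_mono hp fun i => by
    rw [Finsupp.filter_apply]
    split_ifs <;> simp

theorem exists_strictMono_sum_eq {g : ℕ+ → ℕ+ → ℝ} (hg : ∀ i, g i i = 0) {k : ℕ → ℕ+}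
    (hk : Monotone k) (T : ℕ) : ∃ (l : ℕ → ℕ+) (U : ℕ), StrictMono l ∧ l 0 = k 0 ∧
      ∑ t ∈ Finset.range T, g (k t) (k (t + 1)) =
        ∑ t ∈ Finset.range U, g (l t) (l (t + 1)) := by
  induction T generalizing k with
  | zero =>
    exact ⟨fun n => ((k 0).natPred + n).succPNat, 0,
      fun a b hab => Nat.succPNat_lt_succPNat.2 (by omega), by simp, by simp⟩
  | succ T ih =>
    obtain ⟨l, U, hl, hl0, hsum⟩ := ih (hk.comp fun _ _ => Nat.succ_le_succ)
    simp only [Function.comp_apply] at hl0 hsum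
    rw [Finset.sum_range_succ', hsum]
    rcases (hk (Nat.zero_le 1)).eq_or_lt with h | h
    · exact ⟨l, U, hl, hl0.trans h.symm, by rw [h, hg, add_zero]⟩
    · refine ⟨fun t => t.casesOn (k 0) l, U + 1, strictMono_nat_of_lt_succ ?_, rfl, ?_⟩
      · rintro (_ | t)
        exacts [h.trans_eq hl0.symm, hl t.lt_succ_self]
      · rw [Finset.sum_range_succ', ← hl0]
        rfl

theorem sum_rpow_le_of_monotone (hp : 1 ≤ p) (x : ℕ+ →₀ ℝ) {k : ℕ → ℕ+} (hk : Monotone k)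
    (T : ℕ) : ∑ t ∈ Finset.range T, schreierNorm F (intervalProj (k t) (k (t + 1)) x) ^ p ≤
      baernsteinNorm F p x ^ p := by
  obtain ⟨l, U, hl, _, h⟩ := exists_strictMono_sum_eq
    (g := fun m n => schreierNorm F (intervalProj m n x) ^ p)
    (fun i => by rw [intervalProj_self, schreierNorm_zero, Real.zero_rpow (by linarith)]) hk T
  rw [h]
  exact sum_rpow_le_of_strictMono hp x hl U

theorem schreierNorm_le_baernsteinNorm (hp : 1 ≤ p) (x : ℕ+ →₀ ℝ) :
    schreierNorm F x ≤ baernsteinNorm F p x := by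
  obtain ⟨K, hK⟩ : ∃ K : ℕ+, ∀ i ∈ x.support, i ≤ K := x.support.exists_le
  have hx : intervalProj 1 (K + 1) x = x :=
    (Finsupp.filter_eq_self_iff _ _).2 fun i hi =>
      ⟨one_le, PNat.lt_add_one_iff.2 (hK i (Finsupp.mem_support_iff.2 hi))⟩
  have h := sum_rpow_le_of_monotone (F := F) hp x (k := fun t => t.casesOn 1 fun _ => K + 1)
    (monotone_nat_of_le_succ (by rintro (_ | t); exacts [one_le, le_rfl])) 1
  rw [Finset.sum_range_one] at h
  change schreierNorm F (intervalProj 1 (K + 1) x) ^ p ≤ _ at h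
  rw [hx] at h
  exact (Real.rpow_le_rpow_iff (schreierNorm_nonneg F x) (baernsteinNorm_nonneg F p x)
    (by linarith)).1 h

theorem IsSpreading.abs_apply_le_baernsteinNorm (hF : IsSpreading F) (hp : 1 ≤ p)
    (x : ℕ+ →₀ ℝ) (i : ℕ+) : |x i| ≤ baernsteinNorm F p x := by
  simpa using
    (le_schreierNorm (hF.singleton_mem i) x).trans (schreierNorm_le_baernsteinNorm hp x)

theorem baernsteinNorm_rpow_filter_add_le (hp : 1 ≤ p) (x : ℕ+ →₀ ℝ) (m : ℕ+) :
    baernsteinNorm F p (x.filter (· < m)) ^ p + baernsteinNorm F p (x.filter (m ≤ ·)) ^ p ≤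
      baernsteinNorm F p x ^ p := by
  rw [← le_sub_iff_add_le]
  refine baernsteinNorm_rpow_le_of_forall hp fun k hk T => ?_
  rw [le_sub_iff_add_le, ← le_sub_iff_add_le']
  refine baernsteinNorm_rpow_le_of_forall hp fun l hl U => ?_
  rw [le_sub_iff_add_le']
  simp only [intervalProj_filter_lt, intervalProj_filter_ge]
  -- `r` lists the endpoints `min (k t) m` for `t ≤ T`, followed by all `max (l t) m`.
  set r : ℕ → ℕ+ := fun t => if t ≤ T then min (k t) m else max (l (t - (T + 1))) m with hr
  have hr_left : ∀ t ≤ T, r t = min (k t) m := fun t ht => if_pos ht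
  have hr_right : ∀ t, r (T + 1 + t) = max (l t) m := fun t => by
    rw [hr]
    simp only [if_neg (show ¬ T + 1 + t ≤ T by omega), Nat.add_sub_cancel_left]
  have hr_mono : Monotone r := by
    refine monotone_nat_of_le_succ fun t => ?_
    rcases lt_or_ge t T with ht | ht
    · rw [hr_left t ht.le, hr_left (t + 1) ht]
      exact min_le_min_right _ (hk.monotone t.le_succ)
    rcases ht.eq_or_lt with rfl | ht
    · rw [hr_left T le_rfl, hr_right 0]
      exact (min_le_right _ _).trans (le_max_right _ _)
    · obtain ⟨s, rfl⟩ := Nat.exists_eq_add_of_le (Nat.succ_le_of_lt ht)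
      rw [Nat.succ_eq_add_one, hr_right, add_assoc (T + 1), hr_right]
      exact max_le_max_right _ (hl.monotone s.le_succ)
  refine le_trans ?_ (sum_rpow_le_of_monotone hp x hr_mono (T + 1 + U))
  rw [Finset.sum_range_add, Finset.sum_range_succ]
  refine add_le_add (le_add_of_le_of_nonneg (Finset.sum_le_sum fun t ht => ?_)
    (Real.rpow_nonneg (schreierNorm_nonneg F _) _)) (Finset.sum_le_sum fun t _ => ?_)
  · rw [hr_left t (Finset.mem_range.1 ht).le, hr_left (t + 1) (Finset.mem_range.1 ht)]
  · rw [hr_right, add_assoc (T + 1), hr_right]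

theorem sum_schreierNorm_intervalProj_le (x : ℕ+ →₀ ℝ) {k : ℕ → ℕ+} (hk : StrictMono k) (T : ℕ) :
    ∑ t ∈ Finset.range T, schreierNorm F (intervalProj (k t) (k (t + 1)) x) ≤
      ∑ i ∈ x.support, |x i| := by
  set D : ℕ → Finset ℕ+ := fun t => x.support.filter fun i => k t ≤ i ∧ i < k (t + 1)
  have hD : ((Finset.range T : Set ℕ)).PairwiseDisjoint D := fun s _ t _ hst => by
    rw [Function.onFun, Finset.disjoint_left]
    intro i his hit
    have hs := (Finset.mem_filter.1 his).2
    have ht := (Finset.mem_filter.1 hit).2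
    exact hst (le_antisymm (Nat.lt_succ_iff.1 (hk.lt_iff_lt.1 (hs.1.trans_lt ht.2)))
      (Nat.lt_succ_iff.1 (hk.lt_iff_lt.1 (ht.1.trans_lt hs.2))))
  have hpiece : ∀ t, schreierNorm F (intervalProj (k t) (k (t + 1)) x) ≤ ∑ i ∈ D t, |x i| := by
    refine fun t => (schreierNorm_le F _).trans_eq ?_
    rw [intervalProj, Finsupp.support_filter]
    exact Finset.sum_congr rfl fun i hi => by
      rw [Finsupp.filter_apply, if_pos (Finset.mem_filter.1 hi).2]
  refine (Finset.sum_le_sum fun t _ => hpiece t).trans ?_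
  rw [← Finset.sum_biUnion hD]
  exact sum_abs_le _ x

theorem schreierNorm_intervalProj_le (m n : ℕ+) (x : ℕ+ →₀ ℝ) :
    schreierNorm F (intervalProj m n x) ≤ schreierNorm F x :=
  schreierNorm_mono fun i => by
    rw [intervalProj_apply]
    split_ifs <;> simp

theorem baernsteinNorm_rpow_le (hp : 1 ≤ p) (x : ℕ+ →₀ ℝ) :
    baernsteinNorm F p x ^ p ≤ schreierNorm F x ^ (p - 1) * ∑ i ∈ x.support, |x i| := by
  refine baernsteinNorm_rpow_le_of_forall hp fun k hk T => ?_
  refine le_trans ?_ (mul_le_mul_of_nonneg_left (sum_schreierNorm_intervalProj_le (F := F) x hk T)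
    (Real.rpow_nonneg (schreierNorm_nonneg F x) _))
  rw [Finset.mul_sum]
  refine Finset.sum_le_sum fun t _ => ?_
  set u := schreierNorm F (intervalProj (k t) (k (t + 1)) x)
  have hu : 0 ≤ u := schreierNorm_nonneg F _
  calc u ^ p = u ^ (p - 1) * u ^ (1 : ℝ) := by
        rw [← Real.rpow_add_of_nonneg hu (by linarith) zero_le_one, sub_add_cancel]
    _ ≤ schreierNorm F x ^ (p - 1) * u := by
        rw [Real.rpow_one]
        exact mul_le_mul_of_nonneg_right
          (Real.rpow_le_rpow hu (schreierNorm_intervalProj_le _ _ x) (by linarith)) hu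

theorem IsSpreading.baernsteinNorm_single (hF : IsSpreading F) (hp : 1 ≤ p) (n : ℕ+) :
    baernsteinNorm F p (Finsupp.single n 1) = 1 := by
  have hsum : ∑ i ∈ (Finsupp.single n (1 : ℝ)).support, |Finsupp.single n (1 : ℝ) i| = 1 := by
    simp
  refine le_antisymm ?_
    (by simpa using hF.abs_apply_le_baernsteinNorm hp (Finsupp.single n 1) n)
  rw [← Real.rpow_le_rpow_iff (baernsteinNorm_nonneg F p _) zero_le_one (by linarith : 0 < p),
    Real.one_rpow]
  refine (baernsteinNorm_rpow_le hp _).trans ?_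
  rw [hsum, mul_one]
  exact Real.rpow_le_one (schreierNorm_nonneg F _) ((schreierNorm_le F _).trans_eq hsum)
    (by linarith)

theorem IsSpreading.sum_abs_rpow_le (hF : IsSpreading F) (hp : 1 ≤ p) {m : ℕ → ℕ+}
    (hm : StrictMono m) (a : ℕ →₀ ℝ) :
    ∑ j ∈ a.support, |a j| ^ p ≤ baernsteinNorm F p (a.mapDomain m) ^ p := by
  obtain ⟨T, hT⟩ : ∃ T, a.support ⊆ Finset.range T := ⟨_, Finset.subset_range_sup_succ _⟩
  refine le_trans ?_ (sum_rpow_le_of_strictMono hp _ hm T)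
  refine (Finset.sum_le_sum fun j _ => ?_).trans (Finset.sum_le_sum_of_subset_of_nonneg hT
    fun t _ _ => Real.rpow_nonneg (schreierNorm_nonneg F _) _)
  refine Real.rpow_le_rpow (abs_nonneg _) ?_ (by linarith)
  have h := le_schreierNorm (hF.singleton_mem (m j))
    (intervalProj (m j) (m (j + 1)) (a.mapDomain m))
  rwa [Finset.sum_singleton, intervalProj_apply, if_pos ⟨le_rfl, hm j.lt_succ_self⟩,
    Finsupp.mapDomain_apply hm.injective] at h

end BaernsteinNorm

section RightShift

variable {F : Set (Finset ℕ+)} {p : ℝ} {m k : ℕ → ℕ+}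

theorem exists_galoisConnection {α : Type*} [Preorder α] {m : ℕ → α} (hm : Monotone m)
    (h : ∀ i, ∃ n, i ≤ m n) : ∃ ν : α → ℕ, GaloisConnection ν m := by
  classical
  exact ⟨fun i => Nat.find (h i), fun i n =>
    ⟨fun hn => (Nat.find_spec (h i)).trans (hm hn), Nat.find_min' (h i)⟩⟩

theorem exists_le_apply (hm : StrictMono m) (i : ℕ+) : ∃ n, i ≤ m n :=
  (hm.tendsto_atTop.eventually_ge_atTop i).exists

theorem filter_mapDomain {α β M : Type*} [AddCommMonoid M] (f : α → β) (P : β → Prop)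
    [DecidablePred P] (a : α →₀ M) :
    (a.mapDomain f).filter P = (a.filter fun j => P (f j)).mapDomain f := by
  induction a using Finsupp.induction_linear with
  | zero => rw [Finsupp.mapDomain_zero, Finsupp.filter_zero, Finsupp.filter_zero,
      Finsupp.mapDomain_zero]
  | add a b ha hb =>
    rw [Finsupp.filter_add, Finsupp.mapDomain_add, Finsupp.filter_add, Finsupp.mapDomain_add,
      ha, hb]
  | single j t =>
    by_cases h : P (f j)
    · rw [Finsupp.mapDomain_single, Finsupp.filter_single_of_pos P h,
        Finsupp.filter_single_of_pos (fun j => P (f j)) h, Finsupp.mapDomain_single]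
    · rw [Finsupp.mapDomain_single, Finsupp.filter_single_of_neg P h,
        Finsupp.filter_single_of_neg (fun j => P (f j)) h, Finsupp.mapDomain_zero]

theorem intervalProj_mapDomain (m : ℕ → ℕ+) (k l : ℕ+) (a : ℕ →₀ ℝ) :
    intervalProj k l (a.mapDomain m) =
      (a.filter fun j => k ≤ m j ∧ m j < l).mapDomain m :=
  filter_mapDomain m _ a

theorem IsSpreading.baernsteinNorm_mapDomain_le (hF : IsSpreading F) (hp : 1 ≤ p)
    (hm : StrictMono m) (hk : StrictMono k) (hmk : ∀ j, m j ≤ k j) (a : ℕ →₀ ℝ) :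
    baernsteinNorm F p (a.mapDomain m) ≤ baernsteinNorm F p (a.mapDomain k) := by
  refine baernsteinNorm_le_of_forall hp (baernsteinNorm_nonneg F p _) fun l hl T => ?_
  -- `[l, l')` and `[k (ν l), k (ν l'))` contain `m j` and `k j`, respectively, for the same `j`.
  obtain ⟨ν, hν⟩ := exists_galoisConnection hm.monotone (exists_le_apply hm)
  refine (Finset.sum_le_sum fun t _ => ?_).trans (sum_rpow_le_of_monotone hp (a.mapDomain k)
    (k := fun t => k (ν (l t))) (hk.monotone.comp (hν.monotone_l.comp hl.monotone)) T)
  refine Real.rpow_le_rpow (schreierNorm_nonneg F _) ?_ (by linarith)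
  simp only [intervalProj_mapDomain, hk.le_iff_le, hk.lt_iff_lt, hν.le_iff_le, hν.lt_iff_lt]
  exact hF.schreierNorm_mapDomain_le hm hk hmk _

end RightShift

section UpperEstimate

variable {F : Set (Finset ℕ+)} {p : ℝ} {m : ℕ → ℕ+} {z : ℕ → ℕ+ →₀ ℝ}

theorem sum_rpow_le_add_rpow {ι : Type*} {s : Finset ι} {u f g : ι → ℝ} {A B : ℝ} (hp : 1 ≤ p)
    (hu : ∀ t, 0 ≤ u t) (hf : ∀ t, 0 ≤ f t) (hg : ∀ t, 0 ≤ g t) (hA : 0 ≤ A) (hB : 0 ≤ B)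
    (h : ∀ t, u t ≤ f t + g t) (hfA : ∑ t ∈ s, f t ^ p ≤ A ^ p) (hgB : ∑ t ∈ s, g t ^ p ≤ B ^ p) :
    ∑ t ∈ s, u t ^ p ≤ (A + B) ^ p := by
  have hp0 : 0 < p := by linarith
  have rpow_nonneg : ∀ v : ι → ℝ, (∀ t, 0 ≤ v t) → 0 ≤ ∑ t ∈ s, v t ^ p := fun v hv =>
    Finset.sum_nonneg fun t _ => Real.rpow_nonneg (hv t) p
  rw [← Real.rpow_inv_le_iff_of_pos (rpow_nonneg u hu) (add_nonneg hA hB) hp0]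
  calc (∑ t ∈ s, u t ^ p) ^ p⁻¹ ≤ (∑ t ∈ s, (f t + g t) ^ p) ^ p⁻¹ := by
        gcongr with t
        · exact rpow_nonneg u hu
        · exact hu t
        · exact h t
    _ ≤ (∑ t ∈ s, f t ^ p) ^ p⁻¹ + (∑ t ∈ s, g t ^ p) ^ p⁻¹ := by
        simpa only [one_div] using
          Real.Lp_add_le_of_nonneg s hp (fun t _ => hf t) fun t _ => hg t
    _ ≤ A + B := add_le_add
        ((Real.rpow_inv_le_iff_of_pos (rpow_nonneg f hf) hA hp0).2 hfA)
        ((Real.rpow_inv_le_iff_of_pos (rpow_nonneg g hg) hB hp0).2 hgB)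

theorem intervalProj_linearCombination (k l : ℕ+) (z : ℕ → ℕ+ →₀ ℝ) (a : ℕ →₀ ℝ) :
    intervalProj k l (Finsupp.linearCombination ℝ z a) =
      Finsupp.linearCombination ℝ (fun j => intervalProj k l (z j)) a := by
  simp only [Finsupp.linearCombination_apply, Finsupp.sum, intervalProj, Finsupp.filter_sum,
    Finsupp.filter_smul]

theorem linearCombination_filter_congr {w : ℕ → ℕ+ →₀ ℝ} {P Q : ℕ → Prop} [DecidablePred P]
    [DecidablePred Q] (h : ∀ j, w j ≠ 0 → (P j ↔ Q j)) (a : ℕ →₀ ℝ) :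
    Finsupp.linearCombination ℝ w (a.filter P) = Finsupp.linearCombination ℝ w (a.filter Q) := by
  simp only [Finsupp.linearCombination_apply, Finsupp.sum_filter_index, Finsupp.support_filter,
    Finset.sum_filter]
  refine Finset.sum_congr rfl fun j _ => ?_
  by_cases hj : w j = 0
  · simp [hj]
  · simp [h j hj]

theorem BlocksAt.lt_of_intervalProj_ne_zero (hz : BlocksAt m z) {k l : ℕ+} {j : ℕ}
    (h : intervalProj k l (z j) ≠ 0) : k < m (j + 1) ∧ m j < l := by
  obtain ⟨i, hi⟩ := Finsupp.ne_iff.1 h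
  rw [intervalProj_apply, Finsupp.coe_zero, Pi.zero_apply, ite_ne_right_iff] at hi
  have hij := hz.support_subset j (Finsupp.mem_support_iff.2 hi.2)
  exact ⟨hi.1.1.trans_lt hij.2, hij.1.trans_lt hi.1.2⟩

theorem BlocksAt.restrict (hz : BlocksAt m z) (k l : ℕ+) :
    BlocksAt m fun j => intervalProj k l (z j) where
  strictMono := hz.strictMono
  support_subset j := by
    refine subset_trans ?_ (hz.support_subset j)
    rw [intervalProj, Finsupp.support_filter]
    exact_mod_cast Finset.filter_subset _ _

theorem BlocksAt.schreierNorm_intervalProj_linearCombination_le (hz : BlocksAt m z)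
    (hF : IsSpreading F) (hz1 : ∀ j, schreierNorm F (z j) ≤ 1) (k l : ℕ+) (a : ℕ →₀ ℝ) :
    schreierNorm F (intervalProj k l (Finsupp.linearCombination ℝ z a)) ≤
      2 * schreierNorm F (intervalProj k l (a.mapDomain m)) +
        schreierNorm F (Finsupp.linearCombination ℝ
          (fun j => intervalProj k l (z j)) (a.filter (m · < k))) := by
  set w : ℕ → ℕ+ →₀ ℝ := fun j => intervalProj k l (z j)
  have hstart : Finsupp.linearCombination ℝ w (a.filter fun j => ¬ m j < k) =
      Finsupp.linearCombination ℝ w (a.filter fun j => k ≤ m j ∧ m j < l) :=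
    linearCombination_filter_congr (fun j hj => by
      simp only [not_lt, (hz.lt_of_intervalProj_ne_zero hj).2, and_true]) a
  have hsplit : Finsupp.linearCombination ℝ w a =
      Finsupp.linearCombination ℝ w (a.filter fun j => k ≤ m j ∧ m j < l) +
        Finsupp.linearCombination ℝ w (a.filter (m · < k)) := by
    rw [← hstart, ← map_add, add_comm, Finsupp.filter_add_filter_not]
  rw [intervalProj_linearCombination, intervalProj_mapDomain, hsplit]
  refine (schreierNorm_add_le F _ _).trans (add_le_add_left ?_ _)
  refine (hz.restrict k l).schreierNorm_linearCombination_le hF (fun j => ?_) _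
  exact (schreierNorm_intervalProj_le _ _ _).trans (hz1 j)

theorem schreierNorm_linearCombination_rpow_le (hp : 0 < p) {w : ℕ → ℕ+ →₀ ℝ} {a : ℕ →₀ ℝ}
    (h : ∀ i ∈ a.support, ∀ j ∈ a.support, w i ≠ 0 → w j ≠ 0 → i = j) :
    schreierNorm F (Finsupp.linearCombination ℝ w a) ^ p ≤
      ∑ j ∈ a.support, |a j| ^ p * schreierNorm F (w j) ^ p := by
  have hnonneg : ∀ j ∈ a.support, 0 ≤ |a j| ^ p * schreierNorm F (w j) ^ p := fun j _ =>
    mul_nonneg (Real.rpow_nonneg (abs_nonneg _) _) (Real.rpow_nonneg (schreierNorm_nonneg F _) _)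
  rw [Finsupp.linearCombination_apply, Finsupp.sum]
  by_cases hw : ∃ j ∈ a.support, w j ≠ 0
  · obtain ⟨j, hj, hwj⟩ := hw
    have hother : ∀ i ∈ a.support, i ≠ j → a i • w i = 0 := fun i hi hij => by
      rw [by_contra fun hwi => hij (h i hi j hj hwi hwj), smul_zero]
    rw [Finset.sum_eq_single_of_mem j hj hother, schreierNorm_smul,
      Real.mul_rpow (abs_nonneg _) (schreierNorm_nonneg F _)]
    exact Finset.single_le_sum hnonneg hj
  · push Not at hw
    rw [Finset.sum_eq_zero fun j hj => by rw [hw j hj, smul_zero], schreierNorm_zero,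
      Real.zero_rpow hp.ne']
    exact Finset.sum_nonneg hnonneg

theorem BlocksAt.schreierNorm_crossing_rpow_le (hz : BlocksAt m z) (hp : 0 < p) (k l : ℕ+)
    (a : ℕ →₀ ℝ) :
    schreierNorm F (Finsupp.linearCombination ℝ
        (fun j => intervalProj k l (z j)) (a.filter (m · < k))) ^ p ≤
      ∑ j ∈ a.support, |a j| ^ p * schreierNorm F (intervalProj k l (z j)) ^ p := by
  have lt_succ : ∀ i ∈ (a.filter (m · < k)).support, ∀ j,
      intervalProj k l (z j) ≠ 0 → i < j + 1 := fun i hi j hj => by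
    rw [Finsupp.support_filter, Finset.mem_filter] at hi
    exact hz.strictMono.lt_iff_lt.1 (hi.2.trans (hz.lt_of_intervalProj_ne_zero hj).1)
  refine (schreierNorm_linearCombination_rpow_le hp fun i hi j hj hwi hwj =>
    le_antisymm (Nat.lt_succ_iff.1 (lt_succ i hi j hwj))
      (Nat.lt_succ_iff.1 (lt_succ j hj i hwi))).trans ?_
  rw [Finsupp.support_filter, Finset.sum_filter]
  refine Finset.sum_le_sum fun j _ => ?_
  rw [Finsupp.filter_apply]
  split_ifs
  · exact le_rfl
  · exact mul_nonneg (Real.rpow_nonneg (abs_nonneg _) _)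
      (Real.rpow_nonneg (schreierNorm_nonneg F _) _)

theorem BlocksAt.sum_schreierNorm_crossing_rpow_le (hz : BlocksAt m z) (hp : 1 ≤ p)
    (hz1 : ∀ j, baernsteinNorm F p (z j) ≤ 1) {k : ℕ → ℕ+} (hk : StrictMono k) (T : ℕ)
    (a : ℕ →₀ ℝ) :
    ∑ t ∈ Finset.range T, schreierNorm F (Finsupp.linearCombination ℝ
        (fun j => intervalProj (k t) (k (t + 1)) (z j)) (a.filter (m · < k t))) ^ p ≤
      ∑ j ∈ a.support, |a j| ^ p := by
  refine (Finset.sum_le_sum fun t _ =>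
    hz.schreierNorm_crossing_rpow_le (by linarith) (k t) (k (t + 1)) a).trans ?_
  rw [Finset.sum_comm]
  refine Finset.sum_le_sum fun j _ => ?_
  rw [← Finset.mul_sum]
  refine mul_le_of_le_one_right (Real.rpow_nonneg (abs_nonneg _) _) ?_
  exact (sum_rpow_le_of_strictMono hp (z j) hk T).trans
    (Real.rpow_le_one (baernsteinNorm_nonneg F p _) (hz1 j) (by linarith))

theorem BlocksAt.baernsteinNorm_linearCombination_le (hz : BlocksAt m z) (hF : IsSpreading F)
    (hp : 1 ≤ p) (hz1 : ∀ j, baernsteinNorm F p (z j) ≤ 1) (a : ℕ →₀ ℝ) :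
    baernsteinNorm F p (Finsupp.linearCombination ℝ z a) ≤
      3 * baernsteinNorm F p (a.mapDomain m) := by
  set y := a.mapDomain m
  have hy : 0 ≤ baernsteinNorm F p y := baernsteinNorm_nonneg F p y
  refine baernsteinNorm_le_of_forall hp (by positivity) fun k hk T => ?_
  rw [show 3 * baernsteinNorm F p y = 2 * baernsteinNorm F p y + baernsteinNorm F p y by ring]
  refine sum_rpow_le_add_rpow hp (fun t => schreierNorm_nonneg F _)
    (fun t => mul_nonneg zero_le_two (schreierNorm_nonneg F _))
    (fun t => schreierNorm_nonneg F _) (by positivity) hy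
    (fun t => hz.schreierNorm_intervalProj_linearCombination_le hF
      (fun j => (schreierNorm_le_baernsteinNorm hp _).trans (hz1 j)) (k t) (k (t + 1)) a) ?_
    ((hz.sum_schreierNorm_crossing_rpow_le hp hz1 hk T a).trans
      (hF.sum_abs_rpow_le hp hz.strictMono a))
  simp only [Real.mul_rpow zero_le_two (schreierNorm_nonneg F _), Real.mul_rpow zero_le_two hy,
    ← Finset.mul_sum]
  exact mul_le_mul_of_nonneg_left (sum_rpow_le_of_strictMono hp y hk T) (by positivity)

end UpperEstimate

section SmallAveragesOfBlocks

variable {F : Set (Finset ℕ+)} {p : ℝ} {m : ℕ → ℕ+} {z : ℕ → ℕ+ →₀ ℝ}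

theorem IsRegular.exists_baernsteinNorm_mapDomain_le (hF : IsRegular F) (hp : 1 < p)
    (hm : Function.Injective m) {η : ℝ} (hη : 0 < η) :
    ∃ b : StdSimplex ℝ ℕ, baernsteinNorm F p (b.weights.mapDomain m) ≤ η := by
  have hp0 : 0 < p - 1 := sub_pos.2 hp
  obtain ⟨b, hb⟩ := hF.hasSmallAverages.exists_schreierNorm_mapDomain_le hm
    (ε := (η ^ p) ^ (p - 1)⁻¹) (by positivity)
  refine ⟨b, (Real.rpow_le_rpow_iff (baernsteinNorm_nonneg F p _) hη.le
    (zero_lt_one.trans hp)).1 ?_⟩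
  have hsum : ∑ i ∈ (b.weights.mapDomain m).support, |b.weights.mapDomain m i| ≤ 1 :=
    sum_abs_weights_le_one (b.map m) _
  calc baernsteinNorm F p (b.weights.mapDomain m) ^ p
      ≤ schreierNorm F (b.weights.mapDomain m) ^ (p - 1) *
          ∑ i ∈ (b.weights.mapDomain m).support, |b.weights.mapDomain m i| :=
        baernsteinNorm_rpow_le hp.le _
    _ ≤ schreierNorm F (b.weights.mapDomain m) ^ (p - 1) :=
        mul_le_of_le_one_right (Real.rpow_nonneg (schreierNorm_nonneg F _) _) hsum
    _ ≤ ((η ^ p) ^ (p - 1)⁻¹) ^ (p - 1) :=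
        Real.rpow_le_rpow (schreierNorm_nonneg F _) hb hp0.le
    _ = η ^ p := Real.rpow_inv_rpow (by positivity) hp0.ne'

theorem BlocksAt.exists_baernsteinNorm_linearCombination_le (hz : BlocksAt m z)
    (hF : IsRegular F) (hp : 1 < p) (hz1 : ∀ j, baernsteinNorm F p (z j) ≤ 1) {η : ℝ}
    (hη : 0 < η) :
    ∃ b : StdSimplex ℝ ℕ, baernsteinNorm F p (Finsupp.linearCombination ℝ z b.weights) ≤ η := by
  obtain ⟨b, hb⟩ := hF.exists_baernsteinNorm_mapDomain_le hp hz.strictMono.injective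
    (div_pos hη three_pos)
  exact ⟨b, (hz.baernsteinNorm_linearCombination_le hF.toIsSpreading hp.le hz1 _).trans
    ((le_div_iff₀' three_pos).1 hb)⟩

end SmallAveragesOfBlocks

/-! ### The unit vector basis -/

section UnitBasis

variable {F : Set (Finset ℕ+)} {p : ℝ}

/-- The canonical linear map from `c₀₀` to the Baernstein space. -/
def embed (F : Set (Finset ℕ+)) (p : ℝ) (hp : 1 ≤ p) : (ℕ+ →₀ ℝ) →ₗ[ℝ] Space F p hp where
  toFun x := ((PreSpace.of F p hp x : PreSpace F p hp) : Space F p hp)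
  map_add' x y := UniformSpace.Completion.coe_add (α := PreSpace F p hp) (PreSpace.of F p hp x)
    (PreSpace.of F p hp y)
  map_smul' c x := UniformSpace.Completion.coe_smul (X := PreSpace F p hp) c (PreSpace.of F p hp x)

theorem norm_embed (hp : 1 ≤ p) (x : ℕ+ →₀ ℝ) : ‖embed F p hp x‖ = baernsteinNorm F p x :=
  UniformSpace.Completion.norm_coe (E := PreSpace F p hp) (PreSpace.of F p hp x)

theorem denseRange_embed (hp : 1 ≤ p) : DenseRange (embed F p hp) :=
  UniformSpace.Completion.denseRange_coe (α := PreSpace F p hp)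

theorem embed_single_one (hp : 1 ≤ p) (n : ℕ+) :
    embed F p hp (Finsupp.single n 1) = unitVector F p hp n := rfl

theorem embed_single (hp : 1 ≤ p) (n : ℕ+) (t : ℝ) :
    embed F p hp (Finsupp.single n t) = t • unitVector F p hp n := by
  rw [← embed_single_one, ← map_smul, Finsupp.smul_single_one]

theorem embed_indicator (hp : 1 ≤ p) (E : Finset ℕ+) (c : ℕ+ → ℝ) :
    embed F p hp (Finsupp.indicator E fun i _ => c i) =
      ∑ i ∈ E, c i • unitVector F p hp i := by
  simp only [Finsupp.indicator_eq_sum_single, map_sum, embed_single]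

theorem filter_le_eq_indicator {α M : Type*} [Preorder α] [LocallyFiniteOrderBot α]
    [DecidableLE α] [Zero M] (x : α →₀ M) (K : α) :
    x.filter (· ≤ K) = Finsupp.indicator (Finset.Iic K) fun i _ => x i := by
  classical
  ext i
  simp only [Finsupp.filter_apply, Finsupp.indicator_apply, Finset.mem_Iic, dite_eq_ite]

theorem filter_le_indicator_Iic {α M : Type*} [Preorder α] [LocallyFiniteOrderBot α]
    [DecidableLE α] [Zero M] (c : α → M) {N K : α} (h : N ≤ K) :
    (Finsupp.indicator (Finset.Iic K) fun i _ => c i).filter (· ≤ N) =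
      Finsupp.indicator (Finset.Iic N) fun i _ => c i := by
  classical
  ext i
  simp only [Finsupp.filter_apply, Finsupp.indicator_apply, Finset.mem_Iic, dite_eq_ite]
  split_ifs with hN hK
  · rfl
  · exact absurd (hN.trans h) hK
  · rfl

theorem embed_mapDomain (hp : 1 ≤ p) {ι : Type*} (m : ι → ℕ+) (a : ι →₀ ℝ) :
    embed F p hp (a.mapDomain m) = a.sum fun j t => t • unitVector F p hp (m j) := by
  simp only [Finsupp.mapDomain, map_finsuppSum, embed_single]

/-- The coordinate functionals on `c₀₀`, continuous for the Baernstein norm. -/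
def preCoord (hF : IsSpreading F) (hp : 1 ≤ p) (n : ℕ+) : StrongDual ℝ (PreSpace F p hp) :=
  LinearMap.mkContinuous
    { toFun := fun x => (show ℕ+ →₀ ℝ from x) n
      map_add' := fun _ _ => rfl
      map_smul' := fun _ _ => rfl } 1 fun x => by
    rw [one_mul]
    exact hF.abs_apply_le_baernsteinNorm hp x n

/-- The coordinate functionals on the Baernstein space, extended by density from `c₀₀`. -/
def coordFunctional (hF : IsSpreading F) (hp : 1 ≤ p) (n : ℕ+) : StrongDual ℝ (Space F p hp) :=
  (preCoord hF hp n).extend (UniformSpace.Completion.toComplL (𝕜 := ℝ) (E := PreSpace F p hp))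

theorem coordFunctional_embed (hF : IsSpreading F) (hp : 1 ≤ p) (n : ℕ+) (x : ℕ+ →₀ ℝ) :
    coordFunctional hF hp n (embed F p hp x) = x n :=
  ContinuousLinearMap.extend_eq (preCoord hF hp n)
    (UniformSpace.Completion.denseRange_coe)
    (UniformSpace.Completion.isUniformInducing_coe _) (PreSpace.of F p hp x)

/-- The partial sum projection `x ↦ ∑_{i ≤ K} e_i^*(x) e_i`. -/
def partialSum (hF : IsSpreading F) (hp : 1 ≤ p) (K : ℕ+) : Space F p hp →L[ℝ] Space F p hp :=
  ∑ i ∈ Finset.Iic K, (coordFunctional hF hp i).smulRight (unitVector F p hp i)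

theorem partialSum_apply (hF : IsSpreading F) (hp : 1 ≤ p) (K : ℕ+) (x : Space F p hp) :
    partialSum hF hp K x =
      ∑ i ∈ Finset.Iic K, coordFunctional hF hp i x • unitVector F p hp i := by
  simp only [partialSum, sum_apply, ContinuousLinearMap.smulRight_apply]

theorem partialSum_embed (hF : IsSpreading F) (hp : 1 ≤ p) (K : ℕ+) (x : ℕ+ →₀ ℝ) :
    partialSum hF hp K (embed F p hp x) = embed F p hp (x.filter (· ≤ K)) := by
  simp only [partialSum_apply, filter_le_eq_indicator, embed_indicator, coordFunctional_embed]

theorem norm_partialSum_apply_le (hF : IsSpreading F) (hp : 1 ≤ p) (K : ℕ+) (x : Space F p hp) :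
    ‖partialSum hF hp K x‖ ≤ ‖x‖ := by
  refine (denseRange_embed hp).induction_on (p := fun x => ‖partialSum hF hp K x‖ ≤ ‖x‖) x
    (isClosed_le (by fun_prop) continuous_norm) fun y => ?_
  rw [partialSum_embed, norm_embed, norm_embed]
  exact baernsteinNorm_filter_le hp y _

theorem eventually_partialSum_embed_eq (hF : IsSpreading F) (hp : 1 ≤ p) (x : ℕ+ →₀ ℝ) :
    ∀ᶠ K in atTop, partialSum hF hp K (embed F p hp x) = embed F p hp x := by
  obtain ⟨L, hL⟩ : ∃ L : ℕ+, ∀ i ∈ x.support, i ≤ L := x.support.exists_le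
  filter_upwards [eventually_ge_atTop L] with K hK
  rw [partialSum_embed, (Finsupp.filter_eq_self_iff _ _).2 fun i hi =>
    (hL i (Finsupp.mem_support_iff.2 hi)).trans hK]

theorem tendsto_partialSum (hF : IsSpreading F) (hp : 1 ≤ p) (x : Space F p hp) :
    Tendsto (fun K => partialSum hF hp K x) atTop (𝓝 x) := by
  rw [Metric.tendsto_nhds]
  intro ε hε
  obtain ⟨y, hy⟩ := (denseRange_embed hp).exists_dist_lt x (half_pos hε)
  filter_upwards [eventually_partialSum_embed_eq hF hp y] with K hK
  calc dist (partialSum hF hp K x) x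
      ≤ dist (partialSum hF hp K x) (embed F p hp y) + dist (embed F p hp y) x :=
        dist_triangle _ _ _
    _ = ‖partialSum hF hp K (x - embed F p hp y)‖ + dist x (embed F p hp y) := by
        rw [map_sub, hK, dist_eq_norm, dist_comm]
    _ ≤ dist x (embed F p hp y) + dist x (embed F p hp y) := by
        rw [dist_eq_norm]
        gcongr
        exact norm_partialSum_apply_le hF hp K _
    _ < ε := by linarith

/-- The unit vectors as a Schauder basis of the Baernstein space. -/
def unitBasis (hF : IsSpreading F) (hp : 1 ≤ p) : Basis (Space F p hp) where
  basis := unitVector F p hp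
  coord := coordFunctional hF hp
  ortho i j := by
    classical
    rw [← embed_single_one, coordFunctional_embed, Finsupp.single_eq_pi_single]
    congr!
  expansion x := by
    rw [HasSum, SummationFilter.conditional_filter_eq_map_Iic, tendsto_map'_iff]
    exact (tendsto_partialSum hF hp x).congr fun K => partialSum_apply hF hp K x

theorem unitBasis_apply (hF : IsSpreading F) (hp : 1 ≤ p) (n : ℕ+) :
    unitBasis hF hp n = unitVector F p hp n := rfl

theorem norm_unitBasis (hF : IsSpreading F) (hp : 1 ≤ p) (n : ℕ+) : ‖unitBasis hF hp n‖ = 1 := by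
  rw [unitBasis_apply, ← embed_single_one, norm_embed, hF.baernsteinNorm_single hp]

theorem oneUnconditional_unitBasis (hF : IsSpreading F) (hp : 1 ≤ p) :
    OneUnconditional (unitBasis hF hp) := by
  classical
  intro a s hs
  have habs : ∀ i, |Finsupp.indicator a.support (fun i _ => s i * a i) i| =
      |Finsupp.indicator a.support (fun i _ => a i) i| := fun i => by
    simp only [Finsupp.indicator_apply, dite_eq_ite]
    split_ifs
    · rw [abs_mul, hs, one_mul]
    · rfl
  simp only [Finsupp.sum, unitBasis_apply]
  rw [← embed_indicator hp _ fun i => s i * a i, ← embed_indicator hp _ a, norm_embed, norm_embed]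
  exact le_antisymm (baernsteinNorm_mono hp fun i => (habs i).le)
    (baernsteinNorm_mono hp fun i => (habs i).ge)

theorem rightDominant_unitBasis (hF : IsSpreading F) (hp : 1 ≤ p) :
    RightDominant 1 (unitBasis hF hp) := by
  intro m k hm hk hmk a
  simp only [unitBasis_apply]
  rw [one_mul, ← embed_mapDomain, ← embed_mapDomain, norm_embed, norm_embed]
  exact hF.baernsteinNorm_mapDomain_le hp hm hk hmk a

end UnitBasis

section GeneralBases

variable {X U : Type*} [NormedAddCommGroup X] [NormedSpace ℝ X]
  [NormedAddCommGroup U] [NormedSpace ℝ U]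

theorem eq_of_forall_coord_eq (b : Basis X) {x y : X} (h : ∀ n, b.coord n x = b.coord n y) :
    x = y :=
  (b.expansion x).unique <| by simpa only [h] using b.expansion y

theorem comp_proj_mem_span_coord (b : Basis X) (f : StrongDual ℝ X) (A : Finset ℕ+) :
    f ∘L b.proj A ∈ Submodule.span ℝ (Set.range b.coord) := by
  have hsum : f ∘L b.proj A = ∑ i ∈ A, f (b i) • b.coord i := by
    ext x
    simp only [ContinuousLinearMap.comp_apply, GeneralSchauderBasis.proj_apply, map_sum, map_smul,
      sum_apply, smul_apply, smul_eq_mul, mul_comm]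
  rw [hsum]
  exact Submodule.sum_mem _ fun i _ => Submodule.smul_mem _ _ (Submodule.subset_span ⟨i, rfl⟩)

theorem shrinking_of_forall_tendsto_comp_proj {b : Basis X}
    (h : ∀ f : StrongDual ℝ X, Tendsto (fun K => f ∘L b.proj (Finset.Iic K)) atTop (𝓝 f)) :
    Shrinking b :=
  eq_top_iff.2 fun f _ =>
    mem_closure_of_tendsto (h f) (Eventually.of_forall fun _ => comp_proj_mem_span_coord b f _)

theorem cauchySeq_of_norm_sub_rpow_le {E ι : Type*} [SeminormedAddCommGroup E] [SemilatticeSup ι]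
    [Nonempty ι] {u : ι → E} {p : ℝ} (hp : 0 < p)
    (h : ∀ N M, N ≤ M → ‖u M - u N‖ ^ p ≤ ‖u M‖ ^ p - ‖u N‖ ^ p)
    (hu : BddAbove (Set.range fun N => ‖u N‖)) : CauchySeq u := by
  have hmono : Monotone fun N => ‖u N‖ ^ p := fun N M hNM =>
    sub_nonneg.1 ((Real.rpow_nonneg (norm_nonneg _) p).trans (h N M hNM))
  have hbdd : BddAbove (Set.range fun N => ‖u N‖ ^ p) := by
    obtain ⟨B, hB⟩ := hu
    refine ⟨B ^ p, ?_⟩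
    rintro _ ⟨N, rfl⟩
    exact Real.rpow_le_rpow (norm_nonneg _) (hB ⟨N, rfl⟩) hp.le
  have hcauchy := (tendsto_atTop_ciSup hmono hbdd).cauchySeq
  refine Metric.cauchySeq_iff'.2 fun ε hε => ?_
  obtain ⟨N, hN⟩ := Metric.cauchySeq_iff'.1 hcauchy (ε ^ p) (by positivity)
  refine ⟨N, fun M hM => ?_⟩
  rw [dist_eq_norm, ← Real.rpow_lt_rpow_iff (norm_nonneg _) hε.le hp]
  exact (h N M hM).trans_lt ((le_abs_self _).trans_lt (hN M hM))

theorem UpperBlockEstimates.mono {C D : ℝ} {b : Basis X} {u : ℕ+ → U}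
    (h : UpperBlockEstimates C b u) (hCD : C ≤ D) : UpperBlockEstimates D b u :=
  fun z m hz hm a => (h z m hz hm a).trans (mul_le_mul_of_nonneg_right hCD (norm_nonneg _))

end GeneralBases

section UnitBasisProperties

variable {F : Set (Finset ℕ+)} {p : ℝ}

theorem unitBasis_coord_embed (hF : IsSpreading F) (hp : 1 ≤ p) (n : ℕ+) (x : ℕ+ →₀ ℝ) :
    (unitBasis hF hp).coord n (embed F p hp x) = x n :=
  coordFunctional_embed hF hp n x

theorem unitBasis_proj_embed (hF : IsSpreading F) (hp : 1 ≤ p) (K : ℕ+) (x : ℕ+ →₀ ℝ) :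
    (unitBasis hF hp).proj (Finset.Iic K) (embed F p hp x) = embed F p hp (x.filter (· ≤ K)) :=
  partialSum_embed hF hp K x

theorem exists_forall_abs_le_mul_baernsteinNorm (hF : IsRegular F) (hp : 1 < p)
    (f : StrongDual ℝ (Space F p hp.le)) {ε : ℝ} (hε : 0 < ε) :
    ∃ K : ℕ+, ∀ x : ℕ+ →₀ ℝ, (x.support : Set ℕ+) ⊆ Set.Ici K →
      |f (embed F p hp.le x)| ≤ ε * baernsteinNorm F p x := by
  by_contra! h
  obtain ⟨m, z, hz, hzP⟩ := exists_blocksAt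
    (P := fun x => baernsteinNorm F p x ≤ 1 ∧ f (embed F p hp.le x) = ε) fun K => by
      obtain ⟨x, hxK, hx⟩ := h K
      have hfx : 0 < |f (embed F p hp.le x)| :=
        (mul_nonneg hε.le (baernsteinNorm_nonneg F p x)).trans_lt hx
      refine ⟨(ε / f (embed F p hp.le x)) • x, fun i hi => hxK (Finsupp.support_smul hi), ?_, ?_⟩
      · rw [baernsteinNorm_smul F hp.le, abs_div, abs_of_pos hε, div_mul_eq_mul_div]
        exact div_le_one_of_le₀ hx.le hfx.le
      · rw [map_smul, map_smul, smul_eq_mul, div_mul_cancel₀ _ (abs_pos.1 hfx)]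
  obtain ⟨η, hη, hfη⟩ := exists_pos_mul_lt hε ‖f‖
  obtain ⟨b, hb⟩ := hz.exists_baernsteinNorm_linearCombination_le hF hp (fun j => (hzP j).1) hη
  have hfb : f (embed F p hp.le (Finsupp.linearCombination ℝ z b.weights)) = ε := by
    simp only [Finsupp.linearCombination_apply, Finsupp.sum, map_sum, map_smul, (hzP _).2,
      smul_eq_mul, ← Finset.sum_mul]
    rw [show ∑ j ∈ b.weights.support, b.weights j = 1 from b.total, one_mul]
  refine hfη.not_ge ?_
  calc ε = f (embed F p hp.le (Finsupp.linearCombination ℝ z b.weights)) := hfb.symm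
    _ ≤ ‖f‖ * ‖embed F p hp.le (Finsupp.linearCombination ℝ z b.weights)‖ :=
        (le_abs_self _).trans (f.le_opNorm _)
    _ ≤ ‖f‖ * η := by
        rw [norm_embed]
        gcongr

theorem tendsto_comp_proj_unitBasis (hF : IsRegular F) (hp : 1 < p)
    (f : StrongDual ℝ (Space F p hp.le)) :
    Tendsto (fun K => f ∘L (unitBasis hF.toIsSpreading hp.le).proj (Finset.Iic K)) atTop (𝓝 f) := by
  set b := unitBasis hF.toIsSpreading hp.le
  rw [Metric.tendsto_nhds]
  intro ε hε
  obtain ⟨K, hK⟩ := exists_forall_abs_le_mul_baernsteinNorm hF hp f (half_pos hε)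
  filter_upwards [eventually_ge_atTop K] with N hN
  rw [dist_comm, dist_eq_norm]
  refine (ContinuousLinearMap.opNorm_le_bound _ (half_pos hε).le fun x => ?_).trans_lt
    (half_lt_self hε)
  refine (denseRange_embed hp.le).induction_on
    (p := fun x => ‖(f - f ∘L b.proj (Finset.Iic N)) x‖ ≤ ε / 2 * ‖x‖) x
    (isClosed_le (by fun_prop) (by fun_prop)) fun y => ?_
  have htail : (f - f ∘L b.proj (Finset.Iic N)) (embed F p hp.le y) =
      f (embed F p hp.le (y.filter fun i => ¬ i ≤ N)) := by
    rw [sub_apply, ContinuousLinearMap.comp_apply, unitBasis_proj_embed, ← map_sub, ← map_sub,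
      sub_eq_of_eq_add' (Finsupp.filter_add_filter_not y (· ≤ N)).symm]
  rw [htail, norm_embed, Real.norm_eq_abs]
  refine (hK _ fun i hi => ?_).trans
    (mul_le_mul_of_nonneg_left (baernsteinNorm_filter_le hp.le y _) (half_pos hε).le)
  rw [Finset.mem_coe, Finsupp.support_filter, Finset.mem_filter, not_le] at hi
  exact hN.trans hi.2.le

theorem shrinking_unitBasis (hF : IsRegular F) (hp : 1 < p) :
    Shrinking (unitBasis hF.toIsSpreading hp.le) :=
  shrinking_of_forall_tendsto_comp_proj (tendsto_comp_proj_unitBasis hF hp)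

theorem baernsteinNorm_sub_filter_rpow_le (hp : 1 ≤ p) (x : ℕ+ →₀ ℝ) (N : ℕ+) :
    baernsteinNorm F p (x - x.filter (· ≤ N)) ^ p ≤
      baernsteinNorm F p x ^ p - baernsteinNorm F p (x.filter (· ≤ N)) ^ p := by
  have h := baernsteinNorm_rpow_filter_add_le (F := F) hp x (N + 1)
  simp only [PNat.lt_add_one_iff] at h
  simp only [PNat.add_one_le_iff, ← not_le] at h
  rw [sub_eq_of_eq_add' (Finsupp.filter_add_filter_not x (· ≤ N)).symm]
  linarith

theorem boundedlyComplete_unitBasis (hF : IsSpreading F) (hp : 1 ≤ p) :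
    BoundedlyComplete (unitBasis hF hp) := by
  intro c hc
  have hsum : ∀ N : ℕ+, ∑ i ∈ Finset.Icc 1 N, c i • unitBasis hF hp i =
      embed F p hp (Finsupp.indicator (Finset.Iic N) fun i _ => c i) := fun N =>
    (embed_indicator hp (Finset.Iic N) c).symm
  simp only [hsum] at hc ⊢
  refine cauchySeq_tendsto_of_complete
    (cauchySeq_of_norm_sub_rpow_le (zero_lt_one.trans_le hp) (fun N K hNK => ?_) hc)
  rw [← map_sub, norm_embed, norm_embed, norm_embed, ← filter_le_indicator_Iic c hNK]
  exact baernsteinNorm_sub_filter_rpow_le hp _ N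

theorem exists_embed_eq_of_finite_supp (hF : IsSpreading F) (hp : 1 ≤ p) {x : Space F p hp}
    (hx : (supp (unitBasis hF hp) x).Finite) : ∃ y, embed F p hp y = x :=
  ⟨Finsupp.ofSupportFinite (fun i => (unitBasis hF hp).coord i x) hx,
    eq_of_forall_coord_eq (unitBasis hF hp) fun i => unitBasis_coord_embed hF hp i _⟩

theorem upperBlockEstimates_unitBasis (hF : IsSpreading F) (hp : 1 ≤ p) :
    UpperBlockEstimates 3 (unitBasis hF hp) (unitBasis hF hp) := by
  intro z m hz hm a
  choose w hw using fun n => exists_embed_eq_of_finite_supp hF hp (hz.finite_supp n)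
  have hsupp : ∀ n, supp (unitBasis hF hp) (z n) = (w n).support := fun n => by
    ext i
    rw [← hw, supp, Set.mem_ofPred_eq, unitBasis_coord_embed, Finset.mem_coe,
      Finsupp.mem_support_iff]
  have hlt : ∀ n, ∀ i ∈ supp (unitBasis hF hp) (z n), i < m (n + 1) := fun n i hi =>
    hz.successive n i hi _ (hm (n + 1)).1
  have hblocks : BlocksAt m w :=
    ⟨strictMono_nat_of_lt_succ fun n => hlt n _ (hm n).1, fun n i hi =>
      have hi' := (hsupp n).symm ▸ hi
      ⟨(hm n).2 hi', hlt n i hi'⟩⟩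
  have h := hblocks.baernsteinNorm_linearCombination_le hF hp
    (fun n => by rw [← norm_embed hp, hw, hz.norm_eq_one]) a
  rw [← norm_embed hp, ← norm_embed hp, embed_mapDomain, Finsupp.linearCombination_apply,
    map_finsuppSum] at h
  simpa only [map_smul, hw] using! h

end UnitBasisProperties

end Baernstein

end

theorem mainTheorem6_general {F : Set (Finset ℕ+)} (hF : Baernstein.IsRegular F) {p : ℝ}
    (hp : 1 < p) :
    ∃ b : Baernstein.Basis (Baernstein.Space F p hp.le),
      b.basis = Baernstein.unitVector F p hp.le ∧
      (∀ n, ‖b n‖ = 1) ∧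
      Baernstein.OneUnconditional b ∧
      Baernstein.Shrinking b ∧
      Baernstein.BoundedlyComplete b ∧
      Baernstein.RightDominant 1 b ∧
      Baernstein.UpperBlockEstimates 3 b b :=
  ⟨Baernstein.unitBasis hF.toIsSpreading hp.le, rfl,
    Baernstein.norm_unitBasis hF.toIsSpreading hp.le,
    Baernstein.oneUnconditional_unitBasis hF.toIsSpreading hp.le,
    Baernstein.shrinking_unitBasis hF hp,
    Baernstein.boundedlyComplete_unitBasis hF.toIsSpreading hp.le,
    Baernstein.rightDominant_unitBasis hF.toIsSpreading hp.le,
    Baernstein.upperBlockEstimates_unitBasis hF.toIsSpreading hp.le⟩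

theorem mainTheorem6
    (a : Ordinal.{0} → ℕ+ → Ordinal.{0}) (ha : Baernstein.IsLimitSystem a)
    (α : Ordinal.{0}) (hα : α < Ordinal.omega 1) (p : ℝ) (hp : 1 < p) :
    ∃ b : Baernstein.Basis (Baernstein.Space (Baernstein.schreierFamily a α) p hp.le),
      b.basis = Baernstein.unitVector (Baernstein.schreierFamily a α) p hp.le ∧
      (∀ n, ‖b n‖ = 1) ∧
      Baernstein.OneUnconditional b ∧
      Baernstein.Shrinking b ∧
      Baernstein.BoundedlyComplete b ∧
      Baernstein.RightDominant 1 b ∧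
      Baernstein.UpperBlockEstimates 4 b b := by
  obtain ⟨b, hb, hnorm, hunc, hshr, hbdd, hright, hupper⟩ :=
    mainTheorem6_general (Baernstein.isRegular_schreierFamily ha hα) hp
  exact ⟨b, hb, hnorm, hunc, hshr, hbdd, hright, hupper.mono (by norm_num)⟩
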